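/- Let $X,Z$ be topological spaces, $Y\subset Z$, $f:X\to Z$ a continuous map and $C=f^{-1}(Y)$. For $p\ge 0$ let $M_p(C)$ be the set of all closed oriented singular $p$-manifolds in $C$, i.e. continuous maps $s:S\to C$ where $S$ is a closed (compact, without boundary, possibly empty) oriented smooth $p$-manifold. A bordism between closed oriented $p$-manifolds $S_0,S_1$ is a compact oriented smooth $(p+1)$-manifold $W$ with $\partial W=S_0\sqcup(-S_1)$ as oriented manifolds (the boundary being equipped with a collar). Two elements $s_i:S_i\to C$, $i=0,1$, of $M_p(C)$ are Nielsen equivalent, $s_0\sim_N s_1$, if there are a bordism $W$ between $S_0$ and $S_1$, a map $H:W\to X$ extending $s_0\sqcup s_1$, and a map $G:W\to Y$ extending $fs_0\sqcup fs_1$, such that $fH$ and $G$ are homotopic as maps to $Z$ relative to $\partial W=S_0\sqcup S_1$. Let $S'_p(f)=S'_p(f,Y)=M_p(C)/\sim_N$, and write $[s]$ for the class of $s$. Let $F:I\times X\to Z$, $I=[0,1]$, be a homotopy of $f$, i.e. a continuous map with $F(0,x)=f(x)$ for all $x\in X$, define $S'_p(F)=S'_p(F,Y)$ in the same way from $F:I\times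 X\to Z\supset Y$, and let $i:X\to\{0\}\times X\subset I\times X$, $i(x)=(0,x)$, be the inclusion. Theorem. For every $p\ge 0$, $S'_p(f)$ and $S'_p(F)$ are abelian groups under $[s]+[t]=[s\sqcup t]$, and the induced map $i'_*:S'_p(f)\to S'_p(F)$, $i'_*[s]=[is]$, is an injective group homomorphism. -/

import Mathlib

namespace NielsenBordism

open scoped Manifold ContDiff Topology

noncomputable section

/-! ### Orientations of smooth manifolds, possibly with boundary -/

/-- The differential at `x` of the chart of `M` around `x₀`. -/
def chartDeriv {E H M : Type*} [NormedAddCommGroup E] [NormedSpace ℝ E]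
    [TopologicalSpace H] (I : ModelWithCorners ℝ E H) [TopologicalSpace M] [ChartedSpace H M]
    (x₀ x : M) : TangentSpace I x →ₗ[ℝ] E :=
  (mfderiv I 𝓘(ℝ, E) (extChartAt I x₀) x).toLinearMap

/-- A choice `o` of an orientation of every tangent space of an `n`-manifold `M` (modelled on `I`)
is continuous if in the chart around every point it is given, near that point, by one constant
volume form on the model vector space. For `n = 0` this is an arbitrary choice of signs. -/
def IsContinuousOrientation {E H M : Type*} [NormedAddCommGroup E] [NormedSpace ℝ E]
    [TopologicalSpace H] (I : ModelWithCorners ℝ E H) [TopologicalSpace M] [ChartedSpace H M]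
    (n : ℕ) (o : ∀ x : M, Orientation ℝ (TangentSpace I x) (Fin n)) : Prop :=
  ∀ x₀ : M, ∃ η : E [⋀^Fin n]→ₗ[ℝ] ℝ, ∀ᶠ x in 𝓝 x₀,
    ∃ h : η.compLinearMap (chartDeriv I x₀ x) ≠ 0, o x = rayOfNeZero ℝ _ h

/-- The charts of a disjoint union `M ⊔ N` have the same differentials as those of `M`. -/
theorem chartDeriv_inl {p : ℕ} {M N : Type*} [TopologicalSpace M] [TopologicalSpace N]
    [ChartedSpace (EuclideanSpace ℝ (Fin p)) M] [ChartedSpace (EuclideanSpace ℝ (Fin p)) N]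
    [IsManifold (𝓡 p) ∞ M] [IsManifold (𝓡 p) ∞ N] (x₀ x : M)
    (hx : x ∈ (chartAt (EuclideanSpace ℝ (Fin p)) x₀).source) :
    chartDeriv (𝓡 p) (Sum.inl x₀ : M ⊕ N) (Sum.inl x) = chartDeriv (𝓡 p) x₀ x := by
  have : IsManifold (𝓡 p) 1 M := IsManifold.of_le (n := ∞) (by simp)
  have : IsManifold (𝓡 p) 1 N := IsManifold.of_le (n := ∞) (by simp)
  have hx' : (Sum.inl x : M ⊕ N) ∈
      (chartAt (EuclideanSpace ℝ (Fin p)) (Sum.inl x₀ : M ⊕ N)).source := by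
    rw [ChartedSpace.sum_chartAt_inl]
    simpa using hx
  have e : extChartAt (𝓡 p) x₀ = (extChartAt (𝓡 p) (Sum.inl x₀ : M ⊕ N)) ∘ Sum.inl := by
    funext y
    exact extChartAt_inl_apply.symm
  have i := hasMFDerivAt_inl (I := 𝓡 p) (M' := N) (q := x) (p := Sum.inl x)
  have d := HasMFDerivAt.comp x
    (mdifferentiableAt_extChartAt (I := 𝓡 p) hx').hasMFDerivAt i
  rw [← e] at d
  ext v
  simp only [chartDeriv]
  rw [d.mfderiv]
  rfl

/-- The charts of a disjoint union `M ⊔ N` have the same differentials as those of `N`. -/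
theorem chartDeriv_inr {p : ℕ} {M N : Type*} [TopologicalSpace M] [TopologicalSpace N]
    [ChartedSpace (EuclideanSpace ℝ (Fin p)) M] [ChartedSpace (EuclideanSpace ℝ (Fin p)) N]
    [IsManifold (𝓡 p) ∞ M] [IsManifold (𝓡 p) ∞ N] (x₀ x : N)
    (hx : x ∈ (chartAt (EuclideanSpace ℝ (Fin p)) x₀).source) :
    chartDeriv (𝓡 p) (Sum.inr x₀ : M ⊕ N) (Sum.inr x) = chartDeriv (𝓡 p) x₀ x := by
  have : IsManifold (𝓡 p) 1 M := IsManifold.of_le (n := ∞) (by simp)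
  have : IsManifold (𝓡 p) 1 N := IsManifold.of_le (n := ∞) (by simp)
  have hx' : (Sum.inr x : M ⊕ N) ∈
      (chartAt (EuclideanSpace ℝ (Fin p)) (Sum.inr x₀ : M ⊕ N)).source := by
    rw [ChartedSpace.sum_chartAt_inr]
    simpa using hx
  have e : extChartAt (𝓡 p) x₀ = (extChartAt (𝓡 p) (Sum.inr x₀ : M ⊕ N)) ∘ Sum.inr := by
    funext y
    exact extChartAt_inr_apply.symm
  have i := hasMFDerivAt_inr (I := 𝓡 p) (M := M) (q' := x) (p := Sum.inr x)
  have d := HasMFDerivAt.comp x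
    (mdifferentiableAt_extChartAt (I := 𝓡 p) hx').hasMFDerivAt i
  rw [← e] at d
  ext v
  simp only [chartDeriv]
  rw [d.mfderiv]
  rfl

/-! ### Closed oriented manifolds -/

/-- A closed (compact, without boundary) oriented smooth `p`-manifold; it may be empty. -/
structure ClosedManifold (p : ℕ) : Type 1 where
  carrier : Type
  [top : TopologicalSpace carrier]
  [charted : ChartedSpace (EuclideanSpace ℝ (Fin p)) carrier]
  [smooth : IsManifold (𝓡 p) ∞ carrier]
  [compact : CompactSpace carrier]
  [hausdorff : T2Space carrier]
  orient : ∀ x : carrier, Orientation ℝ (TangentSpace (𝓡 p) x) (Fin p)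
  orient_continuous : IsContinuousOrientation (𝓡 p) p orient

attribute [instance] ClosedManifold.top ClosedManifold.charted ClosedManifold.smooth
  ClosedManifold.compact ClosedManifold.hausdorff

namespace ClosedManifold

variable {p : ℕ}

/-- The manifold `-M`: the same manifold with the opposite orientation. -/
def neg (M : ClosedManifold p) : ClosedManifold p where
  carrier := M.carrier
  orient x := -M.orient x
  orient_continuous := by
    intro x₀
    obtain ⟨η, hη⟩ := M.orient_continuous x₀
    refine ⟨-η, hη.mono ?_⟩
    rintro x ⟨h, hx⟩
    have key : (-η).compLinearMap (chartDeriv (𝓡 p) x₀ x) =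
        -(η.compLinearMap (chartDeriv (𝓡 p) x₀ x)) := by
      ext v; simp
    refine ⟨by rw [key]; exact neg_ne_zero.mpr h, ?_⟩
    change -M.orient x = _
    rw [hx, neg_rayOfNeZero]
    simp only [key]

/-- The disjoint union `M ⊔ N`, oriented by the orientations of `M` and `N`. -/
def sum (M N : ClosedManifold p) : ClosedManifold p where
  carrier := M.carrier ⊕ N.carrier
  orient x := match x with
    | Sum.inl x => M.orient x
    | Sum.inr x => N.orient x
  orient_continuous := by
    rintro (x₀ | x₀)
    · obtain ⟨η, hη⟩ := M.orient_continuous x₀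
      refine ⟨η, ?_⟩
      rw [nhds_inl, Filter.eventually_map]
      filter_upwards [hη, (chartAt (EuclideanSpace ℝ (Fin p)) x₀).open_source.mem_nhds
        (mem_chart_source _ x₀)] with x h hx
      rw [chartDeriv_inl x₀ x hx]
      exact h
    · obtain ⟨η, hη⟩ := N.orient_continuous x₀
      refine ⟨η, ?_⟩
      rw [nhds_inr, Filter.eventually_map]
      filter_upwards [hη, (chartAt (EuclideanSpace ℝ (Fin p)) x₀).open_source.mem_nhds
        (mem_chart_source _ x₀)] with x h hx
      rw [chartDeriv_inr x₀ x hx]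
      exact h

end ClosedManifold

/-! ### Compact oriented manifolds with a prescribed boundary -/

/-- The half-space `ℝ^p × [0, ∞)`, on which `(p+1)`-manifolds with boundary are modelled. -/
abbrev HalfSpace (p : ℕ) : Type := ModelProd (EuclideanSpace ℝ (Fin p)) (EuclideanHalfSpace 1)

/-- The vector space `ℝ^p × ℝ` around the half-space `ℝ^p × [0, ∞)`. -/
abbrev HalfSpaceVec (p : ℕ) : Type := EuclideanSpace ℝ (Fin p) × EuclideanSpace ℝ (Fin 1)

/-- The model with corners of the half-space `ℝ^p × [0, ∞)` in `ℝ^p × ℝ`. -/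
abbrev halfModel (p : ℕ) : ModelWithCorners ℝ (HalfSpaceVec p) (HalfSpace p) :=
  (𝓡 p).prod (𝓡∂ 1)

/-- The vector of `ℝ^p × ℝ` that points out of the half-space `ℝ^p × [0, ∞)` orthogonally. -/
def outward (p : ℕ) : HalfSpaceVec p := (0, -EuclideanSpace.single 0 1)

/-- The form `v ↦ η (D ν, D (v₁, 0), …, D (v_p, 0))` on `ℝ^p`, where `ν` is the outward vector:
if `D` is the differential of a collar at a boundary point and `η` represents the orientation of
the manifold there, this form represents the boundary orientation (outward vector first). -/
def boundaryForm {p : ℕ} {T : Type*} [AddCommGroup T] [Module ℝ T]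
    (D : HalfSpaceVec p →ₗ[ℝ] T) (η : T [⋀^Fin (p + 1)]→ₗ[ℝ] ℝ) :
    EuclideanSpace ℝ (Fin p) [⋀^Fin p]→ₗ[ℝ] ℝ :=
  ((η.compLinearMap D).curryLeft (outward p)).compLinearMap
    (LinearMap.inl ℝ (EuclideanSpace ℝ (Fin p)) (EuclideanSpace ℝ (Fin 1)))

/-- A compact oriented smooth `(p+1)`-manifold `W` with (collared) boundary `∂W = N`: the boundary
is identified with the closed oriented `p`-manifold `N` by the restriction to `N × {0}` of a collar,
a diffeomorphism of `N × [0, ∞)` onto an open neighbourhood of `∂W` in `W`, and the orientation of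
`N` is the boundary orientation. -/
structure Filling {p : ℕ} (N : ClosedManifold p) : Type 1 where
  carrier : Type
  [top : TopologicalSpace carrier]
  [charted : ChartedSpace (HalfSpace p) carrier]
  [smooth : IsManifold (halfModel p) ∞ carrier]
  [compact : CompactSpace carrier]
  [hausdorff : T2Space carrier]
  orient : ∀ x : carrier, Orientation ℝ (TangentSpace (halfModel p) x) (Fin (p + 1))
  orient_continuous : IsContinuousOrientation (halfModel p) (p + 1) orient
  collar : N.carrier × EuclideanHalfSpace 1 → carrier
  collar_injective : Function.Injective collar
  collar_diffeo : IsLocalDiffeomorph (halfModel p) (halfModel p) ∞ collar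
  collar_boundary : Set.range (fun x : N.carrier => collar (x, 0)) = (halfModel p).boundary carrier
  collar_orient : ∀ (x : N.carrier)
    (η : TangentSpace (halfModel p) (collar (x, 0)) [⋀^Fin (p + 1)]→ₗ[ℝ] ℝ) (hη : η ≠ 0),
    orient (collar (x, 0)) = rayOfNeZero ℝ η hη →
    ∃ h : boundaryForm
        (mfderiv (halfModel p) (halfModel p) collar (x, 0) :
          HalfSpaceVec p →L[ℝ] TangentSpace (halfModel p) (collar (x, 0))).toLinearMap η ≠ 0,
      N.orient x = rayOfNeZero ℝ _ h

attribute [instance] Filling.top Filling.charted Filling.smooth Filling.compact Filling.hausdorff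

/-- The inclusion `N = ∂W → W` of the boundary. -/
def Filling.bd {p : ℕ} {N : ClosedManifold p} (W : Filling N) (x : N.carrier) : W.carrier :=
  W.collar (x, 0)

/-- A bordism between `M` and `N`: a compact oriented manifold `W` with `∂W = M ⊔ -N`. -/
abbrev Bordism {p : ℕ} (M N : ClosedManifold p) : Type 1 := Filling (M.sum N.neg)

namespace Bordism

variable {p : ℕ} {M N : ClosedManifold p}

/-- The inclusion of the incoming end `M` of a bordism between `M` and `N`. -/
def left (W : Bordism M N) (x : M.carrier) : W.carrier := W.bd (Sum.inl x : M.carrier ⊕ N.carrier)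

/-- The inclusion of the outgoing end `N` of a bordism between `M` and `N`. -/
def right (W : Bordism M N) (x : N.carrier) : W.carrier := W.bd (Sum.inr x : M.carrier ⊕ N.carrier)

end Bordism

/-! ### Singular manifolds and Nielsen classes -/

/-- The set `M_p(A)` of closed oriented singular `p`-manifolds `s : S → A` in a space `A`. -/
structure SingularMfd (p : ℕ) (A : Type*) [TopologicalSpace A] where
  dom : ClosedManifold p
  map : C(dom.carrier, A)

namespace SingularMfd

variable {p : ℕ} {A B : Type*} [TopologicalSpace A] [TopologicalSpace B]

/-- The composition of a singular manifold with a map `k : A → B`. -/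
def push (k : C(A, B)) (s : SingularMfd p A) : SingularMfd p B where
  dom := s.dom
  map := k.comp s.map

/-- The disjoint union `s ⊔ t` of singular manifolds. -/
def sum (s t : SingularMfd p A) : SingularMfd p A where
  dom := s.dom.sum t.dom
  map := ⟨Sum.elim s.map t.map, s.map.continuous.sumElim t.map.continuous⟩

end SingularMfd

section Nielsen

variable {X Z X' Z' : Type*} [TopologicalSpace X] [TopologicalSpace Z]
  [TopologicalSpace X'] [TopologicalSpace Z']

/-- Nielsen equivalence of singular `p`-manifolds `s₀ : S₀ → C` and `s₁ : S₁ → C` in the preimage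
set `C = f⁻¹(Y)`: there are a bordism `W` between `S₀` and `S₁`, a map `H : W → X` extending
`s₀ ⊔ s₁`, and a map `G : W → Y` extending `f s₀ ⊔ f s₁`, such that `f H` and `G` are homotopic,
as maps to `Z`, relative to `∂W = S₀ ⊔ S₁`. -/
def NielsenEquiv (f : C(X, Z)) (Y : Set Z) {p : ℕ} (s₀ s₁ : SingularMfd p (f ⁻¹' Y)) : Prop :=
  ∃ (W : Bordism s₀.dom s₁.dom) (H : C(W.carrier, X)) (G : C(W.carrier, Y)),
    (∀ x, H (W.left x) = s₀.map x) ∧ (∀ x, H (W.right x) = s₁.map x) ∧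
    (∀ x, (G (W.left x) : Z) = f (s₀.map x)) ∧ (∀ x, (G (W.right x) : Z) = f (s₁.map x)) ∧
    ContinuousMap.HomotopicRel (f.comp H)
      (ContinuousMap.comp ⟨Subtype.val, continuous_subtype_val⟩ G)
      (Set.range W.left ∪ Set.range W.right)

/-- `S'_p(f, Y) = M_p(C) / ∼_N`, the Nielsen classes of order `p` of `f`, where `C = f⁻¹(Y)`. -/
def NielsenClasses (f : C(X, Z)) (Y : Set Z) (p : ℕ) : Type _ :=
  Quot (NielsenEquiv f Y (p := p))

/-- The Nielsen class `[s]` of a singular manifold `s` in `f⁻¹(Y)`. -/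
def nielsenClass (f : C(X, Z)) (Y : Set Z) {p : ℕ} (s : SingularMfd p (f ⁻¹' Y)) :
    NielsenClasses f Y p :=
  Quot.mk _ s

/-- A morphism `(k, h)` from the preimage problem `f : X → Z ⊇ Y` to the preimage problem
`f' : X' → Z' ⊇ Y'`, that is, `f' k = h f` and `h(Y) ⊆ Y'`, restricts to a map
`f⁻¹(Y) → f'⁻¹(Y')`. -/
def preimageMap {f : C(X, Z)} {Y : Set Z} {f' : C(X', Z')} {Y' : Set Z'} (k : C(X, X'))
    (h : C(Z, Z')) (comm : ∀ x, f' (k x) = h (f x)) (hY : Set.MapsTo h Y Y') :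
    C(f ⁻¹' Y, f' ⁻¹' Y') where
  toFun x := ⟨k x, by
    have := hY x.2
    rwa [← comm] at this⟩
  continuous_toFun := by fun_prop

/-- Nielsen equivalent singular manifolds have Nielsen equivalent images. -/
theorem NielsenEquiv.push {f : C(X, Z)} {Y : Set Z} {f' : C(X', Z')} {Y' : Set Z'}
    (k : C(X, X')) (h : C(Z, Z')) (comm : ∀ x, f' (k x) = h (f x)) (hY : Set.MapsTo h Y Y')
    {p : ℕ} {s₀ s₁ : SingularMfd p (f ⁻¹' Y)} (hs : NielsenEquiv f Y s₀ s₁) :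
    NielsenEquiv f' Y' (s₀.push (preimageMap k h comm hY)) (s₁.push (preimageMap k h comm hY)) := by
  obtain ⟨W, H, G, h₀, h₁, g₀, g₁, hom⟩ := hs
  refine ⟨W, k.comp H, ⟨fun w => ⟨h (G w), hY (G w).2⟩, by fun_prop⟩, ?_, ?_, ?_, ?_, ?_⟩
  · intro x; exact congrArg k (h₀ x)
  · intro x; exact congrArg k (h₁ x)
  · intro x; exact (congrArg h (g₀ x)).trans (comm _).symm
  · intro x; exact (congrArg h (g₁ x)).trans (comm _).symm
  · have e : f'.comp (k.comp H) = h.comp (f.comp H) := by ext x; exact comm _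
    rw [e]
    exact hom.map (·.compContinuousMap h)

/-- The map `k'_* : S'_p(f, Y) → S'_p(f', Y')`, `k'_*[s] = [k s]`, induced by a morphism `(k, h)`
of preimage problems. -/
def inducedMap {f : C(X, Z)} {Y : Set Z} {f' : C(X', Z')} {Y' : Set Z'} (k : C(X, X'))
    (h : C(Z, Z')) (comm : ∀ x, f' (k x) = h (f x)) (hY : Set.MapsTo h Y Y') (p : ℕ) :
    NielsenClasses f Y p → NielsenClasses f' Y' p :=
  Quot.map (SingularMfd.push (preimageMap k h comm hY))
    fun _ _ hs => hs.push k h comm hY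

end Nielsen

/-- The inclusion `i : X → {0} × X ⊆ I × X`. -/
def inclZero (X : Type*) [TopologicalSpace X] : C(X, unitInterval × X) := ⟨fun x => (0, x), by fun_prop⟩

end

end NielsenBordism

open NielsenBordism

/-!
A Nielsen equivalence is the same as an oriented bordism of singular manifolds in the homotopy
preimage of `Y`, the space of points `x` of `X` and `y` of `Y` with a path from `f x` to `y`: the
three maps `H`, `G` and the homotopy between `f H` and `G` are the components of a single map, and
the homotopy is relative to the boundary when the boundary carries constant paths. So the statement
on the group structure is the classical one that oriented bordism classes form an abelian group.

Cylinders, and the composition of bordisms, both come from one construction. Let an oriented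
manifold be glued to itself along an open subset by a fixed-point-free orientation-preserving
involution with closed graph. The result is an oriented manifold: the projection is a local
homeomorphism, and the transition maps are restrictions of the involution. The subset is a collar
with its boundary removed, and the involution is an orientation-reversing involution of the closed
manifold, multiplied by the reversal `t ↦ 1 / t` of the collar coordinate.

The induced map is injective because a bordism `H : W → I × X` can be pushed to time `0`: if
`H = (t, h)`, then `(r, w) ↦ F (r t, h w)` is a homotopy from `f h` to `F H`, and it is constant
where `t = 0`, in particular on the boundary.
-/

namespace NielsenBordism

open Set Filter

open scoped Manifold ContDiff Topology

noncomputable section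

/-! ### Pulling back orientations along linear maps -/

section PullsBack

variable {n : ℕ} {T T' T'' : Type*} [AddCommGroup T] [Module ℝ T] [AddCommGroup T'] [Module ℝ T']
  [AddCommGroup T''] [Module ℝ T'']

/-- The orientation `o` of `T` is the pull-back of the orientation `o'` of `T'` along the linear map
`D`. This is a relation and not an operation on orientations, because a form on `T'` may pull back
to zero; it has the shape of the boundary condition in `Filling`. -/
def PullsBack (D : T →ₗ[ℝ] T') (o' : Orientation ℝ T' (Fin n)) (o : Orientation ℝ T (Fin n)) :
    Prop :=
  ∀ (η : T' [⋀^Fin n]→ₗ[ℝ] ℝ) (hη : η ≠ 0), o' = rayOfNeZero ℝ η hη →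
    ∃ h : η.compLinearMap D ≠ 0, o = rayOfNeZero ℝ _ h

/-- The pull-back of forms along `D` as a linear map. -/
def formPullback (n : ℕ) (D : T →ₗ[ℝ] T') : T' [⋀^Fin n]→ₗ[ℝ] ℝ →ₗ[ℝ] T [⋀^Fin n]→ₗ[ℝ] ℝ where
  toFun η := η.compLinearMap D
  map_add' _ _ := rfl
  map_smul' _ _ := rfl

theorem formPullback_injective {D : T →ₗ[ℝ] T'} (hD : Function.Surjective D) :
    Function.Injective (formPullback n D) :=
  AlternatingMap.compLinearMap_injective D hD

theorem pullsBack_rayOfNeZero (D : T →ₗ[ℝ] T') {η : T' [⋀^Fin n]→ₗ[ℝ] ℝ} (hη : η ≠ 0)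
    (h : η.compLinearMap D ≠ 0) : PullsBack D (rayOfNeZero ℝ η hη) (rayOfNeZero ℝ _ h) := by
  intro ζ hζ hray
  have same : SameRay ℝ η ζ := (ray_eq_iff hη hζ).1 hray
  obtain ⟨c, hc, rfl⟩ := same.exists_pos_left hη hζ
  have hne : (c • η).compLinearMap D ≠ 0 := smul_ne_zero hc.ne' h
  exact ⟨hne, (ray_eq_iff h hne).2 (same.map (formPullback n D))⟩

theorem PullsBack.eq_rayOfNeZero {D : T →ₗ[ℝ] T'} {η : T' [⋀^Fin n]→ₗ[ℝ] ℝ} {hη : η ≠ 0}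
    {o : Orientation ℝ T (Fin n)} (h : PullsBack D (rayOfNeZero ℝ η hη) o) :
    ∃ h : η.compLinearMap D ≠ 0, o = rayOfNeZero ℝ _ h :=
  h η hη rfl

theorem pullsBack_id (o : Orientation ℝ T (Fin n)) : PullsBack LinearMap.id o o := by
  intro η hη hray
  exact ⟨by simpa only [AlternatingMap.compLinearMap_id] using hη,
    by simpa only [AlternatingMap.compLinearMap_id] using hray⟩

theorem PullsBack.comp {D : T →ₗ[ℝ] T'} {D' : T' →ₗ[ℝ] T''} {o : Orientation ℝ T (Fin n)}
    {o' : Orientation ℝ T' (Fin n)} {o'' : Orientation ℝ T'' (Fin n)}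
    (h' : PullsBack D' o'' o') (h : PullsBack D o' o) : PullsBack (D' ∘ₗ D) o'' o := by
  intro η hη hray
  obtain ⟨hη', hray'⟩ := h' η hη hray
  exact h _ hη' hray'

theorem PullsBack.of_comp {D : T →ₗ[ℝ] T'} {D' : T' →ₗ[ℝ] T''} {o : Orientation ℝ T (Fin n)}
    {o' : Orientation ℝ T' (Fin n)} {o'' : Orientation ℝ T'' (Fin n)}
    (h : PullsBack (D' ∘ₗ D) o'' o) (h' : PullsBack D' o'' o') : PullsBack D o' o := by
  induction o'' using Module.Ray.ind with | h η hη =>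
  obtain ⟨hη', rfl⟩ := h'.eq_rayOfNeZero
  obtain ⟨hη'', rfl⟩ := h.eq_rayOfNeZero
  exact pullsBack_rayOfNeZero D hη' hη''

theorem PullsBack.neg {D : T →ₗ[ℝ] T'} {o : Orientation ℝ T (Fin n)}
    {o' : Orientation ℝ T' (Fin n)} (h : PullsBack D o' o) : PullsBack D (-o') (-o) := by
  induction o' using Module.Ray.ind with | h η hη =>
  obtain ⟨hη', rfl⟩ := h.eq_rayOfNeZero
  rw [neg_rayOfNeZero, neg_rayOfNeZero]
  exact pullsBack_rayOfNeZero D (neg_ne_zero.2 hη) (neg_ne_zero.2 hη')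

theorem PullsBack.unique_right {D : T →ₗ[ℝ] T'} {o₁ o₂ : Orientation ℝ T (Fin n)}
    {o' : Orientation ℝ T' (Fin n)} (h₁ : PullsBack D o' o₁) (h₂ : PullsBack D o' o₂) :
    o₁ = o₂ := by
  induction o' using Module.Ray.ind with | h η hη =>
  obtain ⟨_, rfl⟩ := h₁.eq_rayOfNeZero
  obtain ⟨_, rfl⟩ := h₂.eq_rayOfNeZero
  rfl

theorem PullsBack.unique_left {D : T →ₗ[ℝ] T'} (hD : Function.Surjective D)
    {o : Orientation ℝ T (Fin n)} {o₁ o₂ : Orientation ℝ T' (Fin n)} (h₁ : PullsBack D o₁ o)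
    (h₂ : PullsBack D o₂ o) : o₁ = o₂ := by
  induction o₁ using Module.Ray.ind with | h η₁ hη₁ =>
  induction o₂ using Module.Ray.ind with | h η₂ hη₂ =>
  obtain ⟨hη₁', rfl⟩ := h₁.eq_rayOfNeZero
  obtain ⟨hη₂', hray⟩ := h₂.eq_rayOfNeZero
  exact (ray_eq_iff hη₁ hη₂).2
    ((formPullback_injective hD).sameRay_map_iff.1 ((ray_eq_iff hη₁' hη₂').1 hray))

theorem PullsBack.of_comp_right {D : T →ₗ[ℝ] T'} (hD : Function.Surjective D)
    {D' : T' →ₗ[ℝ] T''} {o : Orientation ℝ T (Fin n)} {o' : Orientation ℝ T' (Fin n)}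
    {o'' : Orientation ℝ T'' (Fin n)} (h : PullsBack (D' ∘ₗ D) o'' o) (h' : PullsBack D o' o) :
    PullsBack D' o'' o' := by
  induction o'' using Module.Ray.ind with | h η hη =>
  obtain ⟨hηD, -⟩ := h.eq_rayOfNeZero
  have hη' : η.compLinearMap D' ≠ 0 := fun h0 => hηD <| by
    rw [← AlternatingMap.compLinearMap_assoc, h0, AlternatingMap.zero_compLinearMap]
  have hD' := pullsBack_rayOfNeZero D' hη hη'
  exact (h.of_comp hD').unique_left hD h' ▸ hD'

theorem exists_pullsBack {D : T →ₗ[ℝ] T'} (hD : Function.Surjective D)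
    (o' : Orientation ℝ T' (Fin n)) : ∃ o : Orientation ℝ T (Fin n), PullsBack D o' o := by
  induction o' using Module.Ray.ind with | h η hη =>
  have hne : η.compLinearMap D ≠ 0 :=
    (map_ne_zero_iff (formPullback n D) (formPullback_injective hD)).2 hη
  exact ⟨_, pullsBack_rayOfNeZero D hη hne⟩

theorem exists_pullsBack_of_bijective {D : T →ₗ[ℝ] T'} (hD : Function.Bijective D)
    (o : Orientation ℝ T (Fin n)) : ∃ o' : Orientation ℝ T' (Fin n), PullsBack D o' o := by
  let e := LinearEquiv.ofBijective D hD
  obtain ⟨o', ho'⟩ := exists_pullsBack (D := e.symm.toLinearMap) e.symm.surjective o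
  refine ⟨o', PullsBack.of_comp (D' := e.symm.toLinearMap) ?_ ho'⟩
  convert pullsBack_id o
  ext v
  exact e.symm_apply_apply v

theorem compLinearMap_eq_det_smul (hn : Module.finrank ℝ T = n) (η : T [⋀^Fin n]→ₗ[ℝ] ℝ)
    (D : T →ₗ[ℝ] T) [FiniteDimensional ℝ T] : η.compLinearMap D = LinearMap.det D • η := by
  let b := Module.finBasisOfFinrankEq ℝ T hn
  rw [η.eq_smul_basis_det b, smul_comm]
  ext v
  exact congrArg (η b * ·) (b.det_comp D v)

theorem pullsBack_self_of_det_pos [FiniteDimensional ℝ T] (hn : Module.finrank ℝ T = n)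
    {D : T →ₗ[ℝ] T} (hD : 0 < LinearMap.det D) (o : Orientation ℝ T (Fin n)) :
    PullsBack D o o := by
  induction o using Module.Ray.ind with | h η hη =>
  have hne : LinearMap.det D • η ≠ 0 := smul_ne_zero hD.ne' hη
  have := pullsBack_rayOfNeZero D hη (compLinearMap_eq_det_smul hn η D ▸ hne)
  simpa only [compLinearMap_eq_det_smul hn, ray_pos_smul hη hD hne] using this

end PullsBack

/-! ### The orientation of the half-space with a prescribed boundary orientation -/

section OutwardFirst

variable {p : ℕ}

/-- The basis of `ℝ^p × ℝ` formed by the outward vector and the standard basis of `ℝ^p`. -/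
def outwardFirstBasis (p : ℕ) : Module.Basis (Fin (p + 1)) ℝ (HalfSpaceVec p) :=
  basisOfTopLeSpanOfCardEqFinrank
    (Fin.cons (outward p) fun i => (EuclideanSpace.single i 1, 0)) (by
      rintro ⟨v, w⟩ -
      have h : (v, w) = (-w 0) • outward p +
          ∑ i, v i • ((EuclideanSpace.single i 1, 0) : HalfSpaceVec p) := by
        ext j <;> simp [outward, Prod.fst_sum, Prod.snd_sum, Pi.single_apply, Fin.eq_zero]
      rw [h]
      refine add_mem (Submodule.smul_mem _ _ (Submodule.subset_span ⟨0, rfl⟩))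
        (sum_mem fun i _ => Submodule.smul_mem _ _ (Submodule.subset_span ⟨i.succ, rfl⟩)))
    (by simp)

theorem coe_outwardFirstBasis : ⇑(outwardFirstBasis p) =
    Fin.cons (outward p) fun i => (EuclideanSpace.single i 1, 0) :=
  coe_basisOfTopLeSpanOfCardEqFinrank _ _ _

/-- The forms of top degree on a space with basis `b` are determined by their value on `b`. -/
def topFormEquiv {n : ℕ} {E : Type*} [AddCommGroup E] [Module ℝ E]
    (b : Module.Basis (Fin n) ℝ E) : (E [⋀^Fin n]→ₗ[ℝ] ℝ) ≃ₗ[ℝ] ℝ where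
  toFun η := η b
  map_add' _ _ := rfl
  map_smul' _ _ := rfl
  invFun c := c • b.det
  left_inv η := (η.eq_smul_basis_det b).symm
  right_inv c := by simp [b.det_self]

/-- `boundaryForm` as an isomorphism between the forms of top degree on `ℝ^p × ℝ` and on `ℝ^p`. -/
def boundaryFormEquiv (p : ℕ) : (HalfSpaceVec p [⋀^Fin (p + 1)]→ₗ[ℝ] ℝ) ≃ₗ[ℝ]
    (EuclideanSpace ℝ (Fin p) [⋀^Fin p]→ₗ[ℝ] ℝ) :=
  topFormEquiv (outwardFirstBasis p) ≪≫ₗ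
    (topFormEquiv (EuclideanSpace.basisFun (Fin p) ℝ).toBasis).symm

theorem boundaryForm_eq_boundaryFormEquiv {T : Type*} [AddCommGroup T] [Module ℝ T]
    (D : HalfSpaceVec p →ₗ[ℝ] T) (η : T [⋀^Fin (p + 1)]→ₗ[ℝ] ℝ) :
    boundaryForm D η = boundaryFormEquiv p (η.compLinearMap D) := by
  rw [boundaryFormEquiv, LinearEquiv.trans_apply, LinearEquiv.eq_symm_apply]
  change η _ = η.compLinearMap D (outwardFirstBasis p)
  rw [coe_outwardFirstBasis]
  refine congrArg η (funext (Fin.cases rfl fun i => ?_))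
  simp

/-- The orientation of `ℝ^p × [0, ∞)` whose boundary orientation is `o`. -/
def outwardFirst (o : Orientation ℝ (EuclideanSpace ℝ (Fin p)) (Fin p)) :
    Orientation ℝ (HalfSpaceVec p) (Fin (p + 1)) :=
  Module.Ray.map (boundaryFormEquiv p).symm o

theorem outwardFirst_rayOfNeZero {η : HalfSpaceVec p [⋀^Fin (p + 1)]→ₗ[ℝ] ℝ} (hη : η ≠ 0)
    (h : boundaryFormEquiv p η ≠ 0) :
    outwardFirst (rayOfNeZero ℝ _ h) = rayOfNeZero ℝ η hη := by
  simp only [outwardFirst, Module.Ray.map_apply, LinearEquiv.symm_apply_apply]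

theorem outwardFirst_neg (o : Orientation ℝ (EuclideanSpace ℝ (Fin p)) (Fin p)) :
    outwardFirst (-o) = -outwardFirst o :=
  Module.Ray.map_neg _ o

theorem boundaryForm_condition_iff_pullsBack {T : Type*} [AddCommGroup T] [Module ℝ T]
    {D : HalfSpaceVec p →ₗ[ℝ] T} {μ : Orientation ℝ T (Fin (p + 1))}
    {o : Orientation ℝ (EuclideanSpace ℝ (Fin p)) (Fin p)} :
    (∀ (η : T [⋀^Fin (p + 1)]→ₗ[ℝ] ℝ) (hη : η ≠ 0), μ = rayOfNeZero ℝ η hη →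
      ∃ h : boundaryForm D η ≠ 0, o = rayOfNeZero ℝ _ h) ↔ PullsBack D μ (outwardFirst o) := by
  refine forall₃_congr fun η hη _ => ?_
  simp only [boundaryForm_eq_boundaryFormEquiv, outwardFirst]
  constructor
  · rintro ⟨h, rfl⟩
    exact ⟨(boundaryFormEquiv p).map_ne_zero_iff.1 h, outwardFirst_rayOfNeZero _ h⟩
  · rintro ⟨h, ho⟩
    refine ⟨(boundaryFormEquiv p).map_ne_zero_iff.2 h, ?_⟩
    rw [← Module.Ray.map_symm, Equiv.symm_apply_eq] at ho
    rw [ho, Module.Ray.map_apply]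

theorem boundaryFormEquiv_compLinearMap {D : HalfSpaceVec p →ₗ[ℝ] HalfSpaceVec p}
    {A : EuclideanSpace ℝ (Fin p) →ₗ[ℝ] EuclideanSpace ℝ (Fin p)} {a : ℝ}
    (hD : ∀ v w, D (v, w) = (A v, a • w)) (η : HalfSpaceVec p [⋀^Fin (p + 1)]→ₗ[ℝ] ℝ) :
    boundaryFormEquiv p (η.compLinearMap D) =
      a • (boundaryFormEquiv p η).compLinearMap A := by
  have outward_smul : D (outward p) = a • outward p := by simp [outward, hD]
  have hid : boundaryFormEquiv p η = boundaryForm LinearMap.id η := by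
    rw [boundaryForm_eq_boundaryFormEquiv, AlternatingMap.compLinearMap_id]
  have tangent : D ∘ₗ LinearMap.inl ℝ _ _ = LinearMap.inl ℝ _ _ ∘ₗ A := by
    ext1 v; simp [hD]
  rw [← boundaryForm_eq_boundaryFormEquiv, hid]
  simp only [boundaryForm]
  rw [AlternatingMap.curryLeft_compLinearMap, outward_smul, map_smul,
    AlternatingMap.compLinearMap_id, AlternatingMap.compLinearMap_assoc,
    AlternatingMap.compLinearMap_assoc, tangent]
  rfl

theorem PullsBack.outwardFirst_units_smul
    {A : EuclideanSpace ℝ (Fin p) →ₗ[ℝ] EuclideanSpace ℝ (Fin p)}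
    {o o' : Orientation ℝ (EuclideanSpace ℝ (Fin p)) (Fin p)} (h : PullsBack A o' o)
    {D : HalfSpaceVec p →ₗ[ℝ] HalfSpaceVec p} (a : ℝˣ)
    (hD : ∀ v w, D (v, w) = (A v, (a : ℝ) • w)) :
    PullsBack D (outwardFirst o') (a • outwardFirst o) := by
  intro η hη hray
  have hη₀ := (boundaryFormEquiv p).map_ne_zero_iff.2 hη
  rw [← outwardFirst_rayOfNeZero hη hη₀] at hray
  obtain ⟨hA, rfl⟩ := h _ hη₀ ((Module.Ray.map _).injective hray)
  have key : η.compLinearMap D = a • (boundaryFormEquiv p).symm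
      ((boundaryFormEquiv p η).compLinearMap A) := by
    rw [← (boundaryFormEquiv p).injective.eq_iff, boundaryFormEquiv_compLinearMap hD,
      Units.smul_def, map_smul, LinearEquiv.apply_symm_apply]
  refine ⟨?_, ?_⟩
  · rw [key, Units.smul_def]
    exact smul_ne_zero a.ne_zero ((boundaryFormEquiv p).symm.map_ne_zero_iff.2 hA)
  · simp only [key, outwardFirst, Module.Ray.map_apply, smul_rayOfNeZero]

theorem PullsBack.outwardFirst_of_pos
    {A : EuclideanSpace ℝ (Fin p) →ₗ[ℝ] EuclideanSpace ℝ (Fin p)}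
    {o o' : Orientation ℝ (EuclideanSpace ℝ (Fin p)) (Fin p)} (h : PullsBack A o' o)
    {D : HalfSpaceVec p →ₗ[ℝ] HalfSpaceVec p} {a : ℝ} (ha : 0 < a)
    (hD : ∀ v w, D (v, w) = (A v, a • w)) : PullsBack D (outwardFirst o') (outwardFirst o) := by
  have := h.outwardFirst_units_smul (Units.mk0 a ha.ne') hD
  rwa [Module.Ray.units_smul_of_pos _ ha] at this

theorem PullsBack.outwardFirst_of_neg
    {A : EuclideanSpace ℝ (Fin p) →ₗ[ℝ] EuclideanSpace ℝ (Fin p)}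
    {o o' : Orientation ℝ (EuclideanSpace ℝ (Fin p)) (Fin p)} (h : PullsBack A o' (-o))
    {D : HalfSpaceVec p →ₗ[ℝ] HalfSpaceVec p} {a : ℝ} (ha : a < 0)
    (hD : ∀ v w, D (v, w) = (A v, a • w)) : PullsBack D (outwardFirst o') (outwardFirst o) := by
  have hneg : Units.mk0 a ha.ne • outwardFirst (-o) = outwardFirst o := by
    rw [Module.Ray.units_smul_of_neg _ ha, outwardFirst_neg]
    exact neg_neg (outwardFirst o)
  exact hneg ▸ h.outwardFirst_units_smul (Units.mk0 a ha.ne) hD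

end OutwardFirst

/-! ### Local diffeomorphisms -/

section LocalDiffeo

variable {E H E' H' E'' H'' : Type*} [NormedAddCommGroup E] [NormedSpace ℝ E] [TopologicalSpace H]
  {I : ModelWithCorners ℝ E H} [NormedAddCommGroup E'] [NormedSpace ℝ E'] [TopologicalSpace H']
  {I' : ModelWithCorners ℝ E' H'} [NormedAddCommGroup E''] [NormedSpace ℝ E'']
  [TopologicalSpace H''] {I'' : ModelWithCorners ℝ E'' H''}
  {M N P : Type*} [TopologicalSpace M] [ChartedSpace H M] [TopologicalSpace N] [ChartedSpace H' N]
  [TopologicalSpace P] [ChartedSpace H'' P]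
  {n : WithTop ℕ∞}

theorem isLocalDiffeomorphAt_of_eventually {f : M → N} {g : N → M} {x : M}
    (hf : ∀ᶠ y in 𝓝 x, ContMDiffAt I I' n f y ∧ g (f y) = y)
    (hg : ∀ᶠ y in 𝓝 (f x), ContMDiffAt I' I n g y ∧ f (g y) = y) :
    IsLocalDiffeomorphAt I I' n f x := by
  obtain ⟨U, hU, hUo, hxU⟩ := eventually_nhds_iff.1 hf
  obtain ⟨V, hV, hVo, hxV⟩ := eventually_nhds_iff.1 hg
  have cf : ContinuousOn f U := fun y hy => (hU y hy).1.continuousAt.continuousWithinAt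
  have cg : ContinuousOn g V := fun y hy => (hV y hy).1.continuousAt.continuousWithinAt
  refine ⟨{ toFun := f
            invFun := g
            source := U ∩ f ⁻¹' V
            target := V ∩ g ⁻¹' U
            map_source' := ?_
            map_target' := ?_
            left_inv' := fun y hy => (hU y hy.1).2
            right_inv' := fun y hy => (hV y hy.1).2
            open_source := cf.isOpen_inter_preimage hUo hVo
            open_target := cg.isOpen_inter_preimage hVo hUo
            contMDiffOn_toFun := fun y hy => (hU y hy.1).1.contMDiffWithinAt
            contMDiffOn_invFun := fun y hy => (hV y hy.1).1.contMDiffWithinAt },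
      ⟨hxU, hxV⟩, fun y _ => rfl⟩
  · rintro y ⟨hy, hy'⟩
    exact ⟨hy', by simpa only [mem_preimage, (hU y hy).2] using hy⟩
  · rintro y ⟨hy, hy'⟩
    exact ⟨hy', by simpa only [mem_preimage, (hV y hy).2] using hy⟩

theorem isLocalDiffeomorphAt_eventually {f : M → N} {x : M}
    (h : IsLocalDiffeomorphAt I I' n f x) : ∀ᶠ y in 𝓝 x, IsLocalDiffeomorphAt I I' n f y := by
  obtain ⟨Φ, hx, e⟩ := h
  filter_upwards [Φ.open_source.mem_nhds hx] with y hy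
  exact ⟨Φ, hy, e⟩

theorem isLocalDiffeomorphAt_congr {f g : M → N} {x : M}
    (h : IsLocalDiffeomorphAt I I' n f x) (e : f =ᶠ[𝓝 x] g) : IsLocalDiffeomorphAt I I' n g x := by
  have e₀ : f x = g x := e.eq_of_nhds
  refine isLocalDiffeomorphAt_of_eventually (g := h.localInverse) ?_ ?_
  · filter_upwards [isLocalDiffeomorphAt_eventually h, e.eventuallyEq_nhds, e,
      h.localInverse.open_target.mem_nhds h.localInverse_mem_target] with y h₁ h₂ h₃ h₄
    exact ⟨h₁.contMDiffAt.congr_of_eventuallyEq h₂.symm, by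
      rw [← h₃]; exact h.localInverse_left_inv h₄⟩
  · have c : Tendsto h.localInverse (𝓝 (f x)) (𝓝 x) := by
      have := h.localInverse_contMDiffAt.continuousAt
      rwa [ContinuousAt, h.localInverse_left_inv h.localInverse_mem_target] at this
    rw [← e₀]
    filter_upwards [h.localInverse.open_source.mem_nhds h.localInverse_mem_source, c.eventually e]
      with y h₁ h₂
    exact ⟨h.localInverse_contMDiffOn.contMDiffAt (h.localInverse.open_source.mem_nhds h₁), by
      rw [← h₂]; exact h.localInverse_right_inv h₁⟩

theorem isLocalDiffeomorphAt_of_comp_right {f : M → N} {g : N → P} {x : M}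
    (hf : IsLocalDiffeomorphAt I I' n f x) (hgf : IsLocalDiffeomorphAt I I'' n (g ∘ f) x) :
    IsLocalDiffeomorphAt I' I'' n g (f x) := by
  have h := hf.localInverse_isLocalDiffeomorphAt
  have e := hf.localInverse_left_inv hf.localInverse_mem_target
  refine isLocalDiffeomorphAt_congr (h.comp _ _ (g := g ∘ f) (by rwa [e])) ?_
  filter_upwards [hf.localInverse.open_source.mem_nhds hf.localInverse_mem_source] with y hy
  exact congrArg g (hf.localInverse_right_inv hy)

theorem isLocalDiffeomorphAt_of_comp_left {f : M → N} {g : N → P} {x : M}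
    (hg : IsLocalDiffeomorphAt I' I'' n g (f x)) (hgf : IsLocalDiffeomorphAt I I'' n (g ∘ f) x)
    (hf : ContinuousAt f x) : IsLocalDiffeomorphAt I I' n f x := by
  have h := hg.localInverse_isLocalDiffeomorphAt
  refine isLocalDiffeomorphAt_congr (hgf.comp _ _ h) ?_
  filter_upwards [hf.preimage_mem_nhds
    (hg.localInverse.open_target.mem_nhds hg.localInverse_mem_target)] with y hy
  exact hg.localInverse_left_inv hy

theorem map_nhds_of_isLocalDiffeomorphAt {f : M → N} {x : M}
    (h : IsLocalDiffeomorphAt I I' n f x) : map f (𝓝 x) = 𝓝 (f x) := by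
  obtain ⟨Φ, hx, e⟩ := h
  rw [map_congr (e.eventuallyEq_of_mem (Φ.open_source.mem_nhds hx)), e hx]
  exact Φ.toOpenPartialHomeomorph.map_nhds_eq hx

theorem isLocalDiffeomorphAt_id (x : M) : IsLocalDiffeomorphAt I I n (id : M → M) x :=
  (Diffeomorph.refl I M n).isLocalDiffeomorph x

theorem isLocalDiffeomorphAt_chartAt [IsManifold I n M] (x : M) :
    IsLocalDiffeomorphAt I I n (chartAt H x) x :=
  ⟨{ toPartialEquiv := (chartAt H x).toPartialEquiv
     open_source := (chartAt H x).open_source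
     open_target := (chartAt H x).open_target
     contMDiffOn_toFun := contMDiffOn_chart
     contMDiffOn_invFun := contMDiffOn_chart_symm }, mem_chart_source H x, fun _ _ => rfl⟩

theorem isLocalDiffeomorphAt_subtypeVal (U : TopologicalSpace.Opens M) (x : U) :
    IsLocalDiffeomorphAt I I ∞ (Subtype.val : U → M) x := by
  classical
  let g : M → U := fun y => if h : y ∈ U then ⟨y, h⟩ else x
  have hg (y : M) (hy : y ∈ U) : (g y : M) = y := by simp [g, hy]
  refine isLocalDiffeomorphAt_of_eventually (g := g)
    (Eventually.of_forall fun y => ⟨contMDiff_subtype_val y, Subtype.ext (hg y y.2)⟩) ?_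
  filter_upwards [U.isOpen.mem_nhds x.2] with y hy
  refine ⟨?_, hg y hy⟩
  rw [← ContMDiffAt.subtypeVal_comp_iff]
  refine contMDiffAt_id.congr_of_eventuallyEq ?_
  filter_upwards [U.isOpen.mem_nhds hy] with z hz
  exact hg z hz

variable {M₁ : Type*} [TopologicalSpace M₁] [ChartedSpace H M₁]

theorem isLocalDiffeomorphAt_inl (x : M) :
    IsLocalDiffeomorphAt I I n (Sum.inl : M → M ⊕ M₁) x := by
  refine isLocalDiffeomorphAt_of_eventually (g := Sum.elim id fun _ => x)
    (Eventually.of_forall fun y => ⟨ContMDiff.inl y, rfl⟩) ?_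
  rw [nhds_inl, eventually_map]
  exact Eventually.of_forall fun y =>
    ⟨ContMDiff.sumElim contMDiff_id contMDiff_const (Sum.inl y), rfl⟩

theorem isLocalDiffeomorphAt_inr (x : M₁) :
    IsLocalDiffeomorphAt I I n (Sum.inr : M₁ → M ⊕ M₁) x := by
  refine isLocalDiffeomorphAt_of_eventually (g := Sum.elim (fun _ => x) id)
    (Eventually.of_forall fun y => ⟨ContMDiff.inr y, rfl⟩) ?_
  rw [nhds_inr, eventually_map]
  exact Eventually.of_forall fun y =>
    ⟨ContMDiff.sumElim contMDiff_const contMDiff_id (Sum.inr y), rfl⟩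

theorem isLocalDiffeomorphAt_prodMap {H₃ E₃ : Type*} [NormedAddCommGroup E₃]
    [NormedSpace ℝ E₃] [TopologicalSpace H₃] {I₃ : ModelWithCorners ℝ E₃ H₃} {Q : Type*}
    [TopologicalSpace Q] [ChartedSpace H₃ Q] {f : M → N} {g : P → Q} {x : M} {y : P}
    (hf : IsLocalDiffeomorphAt I I' n f x) (hg : IsLocalDiffeomorphAt I'' I₃ n g y) :
    IsLocalDiffeomorphAt (I.prod I'') (I'.prod I₃) n (Prod.map f g) (x, y) := by
  obtain ⟨Φ, hx, e⟩ := hf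
  obtain ⟨Ψ, hy, e'⟩ := hg
  refine ⟨{ toPartialEquiv := Φ.toPartialEquiv.prod Ψ.toPartialEquiv
            open_source := Φ.open_source.prod Ψ.open_source
            open_target := Φ.open_target.prod Ψ.open_target
            contMDiffOn_toFun := Φ.contMDiffOn_toFun.prodMap Ψ.contMDiffOn_toFun
            contMDiffOn_invFun := Φ.contMDiffOn_invFun.prodMap Ψ.contMDiffOn_invFun },
    ⟨hx, hy⟩, ?_⟩
  rintro ⟨a, b⟩ ⟨ha, hb⟩
  exact Prod.ext (e ha) (e' hb)

end LocalDiffeo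

/-! ### Oriented local diffeomorphisms and continuous orientations -/

section Oriented

variable {n : ℕ} {E H : Type*} [NormedAddCommGroup E] [NormedSpace ℝ E] [TopologicalSpace H]
  {I : ModelWithCorners ℝ E H}
  {M N P : Type*} [TopologicalSpace M] [ChartedSpace H M] [TopologicalSpace N] [ChartedSpace H N]
  [TopologicalSpace P] [ChartedSpace H P]

/-- The differential at `x` of a map between manifolds with the same model. Tangent spaces being
copies of the model vector space `E`, it is regarded as an endomorphism of `E`, which makes
determinants and composites available. -/
def derivAt (I : ModelWithCorners ℝ E H) (φ : M → N) (x : M) : E →ₗ[ℝ] E :=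
  (mfderiv I I φ x : E →L[ℝ] E).toLinearMap

/-- `chartDeriv`, regarded as an endomorphism of the model vector space. -/
def chartEnd (I : ModelWithCorners ℝ E H) (x₀ x : M) : E →ₗ[ℝ] E := chartDeriv I x₀ x

/-- The map `φ` is, at `x`, a local diffeomorphism preserving the given orientations of the tangent
spaces. -/
structure OrientedAt (I : ModelWithCorners ℝ E H) (o : M → Orientation ℝ E (Fin n))
    (o' : N → Orientation ℝ E (Fin n)) (φ : M → N) (x : M) : Prop where
  diffeo : IsLocalDiffeomorphAt I I ∞ φ x
  pullsBack : PullsBack (derivAt I φ x) (o' (φ x)) (o x)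

/-- The choice `o` of orientations of tangent spaces is continuous at `x₀`: near `x₀` it is constant
in the chart around `x₀`. -/
def ContOrientAt (I : ModelWithCorners ℝ E H) (o : M → Orientation ℝ E (Fin n)) (x₀ : M) : Prop :=
  ∃ a : Orientation ℝ E (Fin n), ∀ᶠ x in 𝓝 x₀, PullsBack (chartEnd I x₀ x) a (o x)

theorem isContinuousOrientation_iff {o : M → Orientation ℝ E (Fin n)} :
    IsContinuousOrientation I n o ↔ ∀ x, ContOrientAt I o x := by
  refine forall_congr' fun x₀ => ⟨?_, ?_⟩
  · rintro ⟨η, hη⟩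
    have hη₀ : η ≠ 0 := by
      rintro rfl
      obtain ⟨h, -⟩ := hη.self_of_nhds
      exact h (AlternatingMap.zero_compLinearMap _)
    refine ⟨rayOfNeZero ℝ η hη₀, hη.mono ?_⟩
    rintro x ⟨h, hx⟩
    exact hx ▸ pullsBack_rayOfNeZero _ hη₀ h
  · rintro ⟨a, ha⟩
    induction a using Module.Ray.ind with | h η hη =>
    exact ⟨η, ha.mono fun x hx => hx.eq_rayOfNeZero⟩

theorem derivAt_comp {φ : M → N} {ψ : N → P} {x : M} (hφ : IsLocalDiffeomorphAt I I ∞ φ x)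
    (hψ : IsLocalDiffeomorphAt I I ∞ ψ (φ x)) :
    derivAt I (ψ ∘ φ) x = derivAt I ψ (φ x) ∘ₗ derivAt I φ x := by
  rw [derivAt, mfderiv_comp x (hψ.mdifferentiableAt (by simp)) (hφ.mdifferentiableAt (by simp))]
  rfl

theorem derivAt_bijective {φ : M → N} {x : M} (hφ : IsLocalDiffeomorphAt I I ∞ φ x) :
    Function.Bijective (derivAt I φ x) :=
  (hφ.mfderivToContinuousLinearEquiv (by simp)).bijective

theorem chartEnd_self (x : M) [IsManifold I 1 M] : chartEnd I x x = LinearMap.id :=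
  congrArg ContinuousLinearMap.toLinearMap (mfderiv_extChartAt_self (I := I) (x := x))

theorem chartEnd_surjective [IsManifold I 1 M] {x₀ x : M} (hx : x ∈ (chartAt H x₀).source) :
    Function.Surjective (chartEnd I x₀ x) := by
  obtain ⟨e, he⟩ := isInvertible_mfderiv_extChartAt (I := I) (x := x₀) (y := x)
    (by rwa [extChartAt_source])
  exact fun v => ⟨e.symm v, (congrArg (· (e.symm v)) he.symm).trans (e.apply_symm_apply v)⟩

variable {o : M → Orientation ℝ E (Fin n)} {o' : N → Orientation ℝ E (Fin n)}
  {o'' : P → Orientation ℝ E (Fin n)} {φ : M → N} {ψ : N → P} {x : M}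

theorem OrientedAt.comp (hψ : OrientedAt I o' o'' ψ (φ x)) (hφ : OrientedAt I o o' φ x) :
    OrientedAt I o o'' (ψ ∘ φ) x where
  diffeo := hφ.diffeo.comp _ _ hψ.diffeo
  pullsBack := derivAt_comp hφ.diffeo hψ.diffeo ▸ hψ.pullsBack.comp hφ.pullsBack

theorem OrientedAt.congr {φ' : M → N} (hφ : OrientedAt I o o' φ x) (e : φ =ᶠ[𝓝 x] φ') :
    OrientedAt I o o' φ' x where
  diffeo := isLocalDiffeomorphAt_congr hφ.diffeo e
  pullsBack := by
    have h : derivAt I φ' x = derivAt I φ x := by rw [derivAt, derivAt, e.mfderiv_eq]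
    rw [h, ← e.eq_of_nhds]
    exact hφ.pullsBack

theorem OrientedAt.of_comp_right (hφ : OrientedAt I o o' φ x)
    (h : OrientedAt I o o'' (ψ ∘ φ) x) : OrientedAt I o' o'' ψ (φ x) where
  diffeo := isLocalDiffeomorphAt_of_comp_right hφ.diffeo h.diffeo
  pullsBack := by
    have hψ := isLocalDiffeomorphAt_of_comp_right hφ.diffeo h.diffeo
    have hcomp := h.pullsBack
    rw [derivAt_comp hφ.diffeo hψ] at hcomp
    exact hcomp.of_comp_right (derivAt_bijective hφ.diffeo).surjective hφ.pullsBack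

theorem OrientedAt.of_comp_left (hψ : OrientedAt I o' o'' ψ (φ x))
    (h : OrientedAt I o o'' (ψ ∘ φ) x) (hφ : ContinuousAt φ x) : OrientedAt I o o' φ x where
  diffeo := isLocalDiffeomorphAt_of_comp_left hψ.diffeo h.diffeo hφ
  pullsBack := by
    have hφ' := isLocalDiffeomorphAt_of_comp_left hψ.diffeo h.diffeo hφ
    have hcomp := h.pullsBack
    rw [derivAt_comp hφ' hψ.diffeo] at hcomp
    exact hcomp.of_comp hψ.pullsBack

theorem OrientedAt.neg (h : OrientedAt I o o' φ x) :
    OrientedAt I (fun y => -o y) (fun y => -o' y) φ x :=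
  ⟨h.diffeo, h.pullsBack.neg⟩

theorem orientedAt_id (o : M → Orientation ℝ E (Fin n)) (x : M) : OrientedAt I o o id x where
  diffeo := isLocalDiffeomorphAt_id x
  pullsBack := by
    rw [derivAt, mfderiv_id]
    exact pullsBack_id _

/-- The orientation of `M` making the local diffeomorphism `φ : M → N` oriented. -/
def pullbackOrient (hφ : IsLocalDiffeomorph I I ∞ φ) (o' : N → Orientation ℝ E (Fin n)) (x : M) :
    Orientation ℝ E (Fin n) :=
  (exists_pullsBack (derivAt_bijective (hφ x)).surjective (o' (φ x))).choose

theorem orientedAt_pullbackOrient (hφ : IsLocalDiffeomorph I I ∞ φ)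
    (o' : N → Orientation ℝ E (Fin n)) (x : M) : OrientedAt I (pullbackOrient hφ o') o' φ x :=
  ⟨hφ x, (exists_pullsBack (derivAt_bijective (hφ x)).surjective (o' (φ x))).choose_spec⟩

theorem ContOrientAt.neg (h : ContOrientAt I o x) : ContOrientAt I (fun y => -o y) x := by
  obtain ⟨a, ha⟩ := h
  exact ⟨-a, ha.mono fun _ hy => hy.neg⟩

theorem exists_derivAt_in_charts [IsManifold I 1 M] [IsManifold I 1 N]
    (hφ : ContMDiffAt I I 1 φ x) : ∃ L : M → E →L[ℝ] E, ContinuousAt L x ∧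
      ∀ᶠ y in 𝓝 x, chartEnd I (φ x) (φ y) ∘ₗ derivAt I φ y =
        (L y).toLinearMap ∘ₗ chartEnd I x y := by
  refine ⟨inTangentCoordinates I I id φ (fun y => (mfderiv I I φ y : E →L[ℝ] E)) x,
    (hφ.mfderiv_const (m := 0) (by simp)).continuousAt, ?_⟩
  filter_upwards [extChartAt_source_mem_nhds (I := I) x,
    hφ.continuousAt.preimage_mem_nhds (chart_source_mem_nhds H (φ x))] with y hy hy'
  have hL := inTangentCoordinates_eq_mfderiv_comp (I := I) (I' := I) (f := id) (g := φ)
    (ϕ := fun y => mfderiv I I φ y) (x₀ := x) (x := y) (by simpa using hy) hy'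
  have chart_symm_comp := mfderivWithin_extChartAt_symm_comp_mfderiv_extChartAt' (I := I) hy
  ext v
  rw [LinearMap.comp_apply, LinearMap.comp_apply, ContinuousLinearMap.coe_coe, hL]
  exact (congrArg (fun A => mfderiv I 𝓘(ℝ, E) (extChartAt I (φ x)) (φ y)
    (mfderiv I I φ y (A v))) chart_symm_comp).symm

theorem eventually_det_comp_pos {X : Type*} [TopologicalSpace X]
    {L : X → E →L[ℝ] E} {x : X} (hL : ContinuousAt L x) {A : E →L[ℝ] E}
    (hA : A ∘L L x = ContinuousLinearMap.id ℝ E) :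
    ∀ᶠ y in 𝓝 x, 0 < LinearMap.det (A.toLinearMap ∘ₗ (L y).toLinearMap) := by
  have cont : ContinuousAt (fun y => (A ∘L L y).det) x :=
    ContinuousLinearMap.continuous_det.continuousAt.comp (continuousAt_const.clm_comp hL)
  refine cont.eventually_const_lt ?_
  change 0 < (A ∘L L x).det
  rw [hA]
  simp [ContinuousLinearMap.det]

theorem ContOrientAt.map [FiniteDimensional ℝ E] [IsManifold I 1 M] [IsManifold I 1 N]
    (hn : Module.finrank ℝ E = n) (h : ∀ᶠ y in 𝓝 x, OrientedAt I o o' φ y)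
    (hx : ContOrientAt I o x) : ContOrientAt I o' (φ x) := by
  obtain ⟨a, ha⟩ := hx
  have hφ := h.self_of_nhds.diffeo
  obtain ⟨L, hL, hcharts⟩ := exists_derivAt_in_charts (hφ.contMDiffAt.of_le (by simp))
  have hLx : (L x).toLinearMap = derivAt I φ x := by
    simpa only [chartEnd_self, LinearMap.id_comp, LinearMap.comp_id] using
      hcharts.self_of_nhds.symm
  let e : E ≃L[ℝ] E := hφ.mfderivToContinuousLinearEquiv (n := ∞) (by simp)
  let A : E →L[ℝ] E := e.symm
  have hA : A ∘L L x = ContinuousLinearMap.id ℝ E := by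
    ext v
    exact (congrArg A (LinearMap.congr_fun hLx v)).trans (e.symm_apply_apply v)
  obtain ⟨b, hb⟩ := exists_pullsBack (D := A.toLinearMap) e.symm.surjective a
  refine ⟨b, ?_⟩
  rw [← map_nhds_of_isLocalDiffeomorphAt hφ, eventually_map]
  filter_upwards [ha, hcharts, eventually_det_comp_pos hL hA, h] with y ha hchart hdet h
  have hLy : PullsBack (L y).toLinearMap b a := (pullsBack_self_of_det_pos hn hdet a).of_comp hb
  refine PullsBack.of_comp_right (derivAt_bijective h.diffeo).surjective ?_ h.pullsBack
  exact hchart ▸ hLy.comp ha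

theorem ContOrientAt.comap [FiniteDimensional ℝ E] [IsManifold I 1 M] [IsManifold I 1 N]
    (hn : Module.finrank ℝ E = n) (h : ∀ᶠ y in 𝓝 x, OrientedAt I o o' φ y)
    (hx : ContOrientAt I o' (φ x)) : ContOrientAt I o x := by
  have hφ := h.self_of_nhds.diffeo
  rw [← hφ.localInverse_left_inv hφ.localInverse_mem_target]
  refine hx.map hn ?_
  rw [← map_nhds_of_isLocalDiffeomorphAt hφ, eventually_map]
  filter_upwards [h, hφ.localInverse_eventuallyEq_left.eventuallyEq_nhds] with y hy hinv
  exact hy.of_comp_right ((orientedAt_id o y).congr hinv.symm)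

theorem ContOrientAt.eventually_eq_or [IsManifold I 1 M] {o₁ o₂ : M → Orientation ℝ E (Fin n)}
    (h₁ : ContOrientAt I o₁ x) (h₂ : ContOrientAt I o₂ x) :
    (∀ᶠ y in 𝓝 x, o₁ y = o₂ y) ∨ ∀ᶠ y in 𝓝 x, o₁ y ≠ o₂ y := by
  obtain ⟨a₁, h₁⟩ := h₁
  obtain ⟨a₂, h₂⟩ := h₂
  rcases eq_or_ne a₁ a₂ with rfl | hne
  · left
    filter_upwards [h₁, h₂] with y h₁ h₂
    exact h₁.unique_right h₂
  · right
    filter_upwards [h₁, h₂, chart_source_mem_nhds H x] with y h₁ h₂ hy heq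
    exact hne (h₁.unique_left (chartEnd_surjective hy) (heq ▸ h₂))

theorem eqOn_of_contOrientAt [IsManifold I 1 M] {o₁ o₂ : M → Orientation ℝ E (Fin n)}
    (h₁ : ∀ x, ContOrientAt I o₁ x) (h₂ : ∀ x, ContOrientAt I o₂ x) {s : Set M}
    (hs : IsPreconnected s) (hx : x ∈ s) (heq : o₁ x = o₂ x) : EqOn o₁ o₂ s := by
  have hclopen : IsClopen {z | o₁ z = o₂ z} := by
    refine ⟨isOpen_compl_iff.1 (isOpen_iff_mem_nhds.2 fun z hz => ?_),
      isOpen_iff_mem_nhds.2 fun z hz => ?_⟩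
    · exact ((h₁ z).eventually_eq_or (h₂ z)).resolve_left fun h => hz h.self_of_nhds
    · exact ((h₁ z).eventually_eq_or (h₂ z)).resolve_right fun h => h.self_of_nhds hz
  exact fun y hy => hs.subset_isClopen hclopen ⟨x, hx, heq⟩ hy

end Oriented

/-! ### Gluing an oriented manifold to itself -/

section LocalHomeomorph

variable {E H : Type*} [NormedAddCommGroup E] [NormedSpace ℝ E] [TopologicalSpace H]
  {I : ModelWithCorners ℝ E H} {V Q : Type*} [TopologicalSpace V] [ChartedSpace H V]
  [TopologicalSpace Q] {q : V → Q} {g : Q → V}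

theorem contDiffOn_of_contMDiffOn_model {f : H → H} {s : Set H} (hf : ContMDiffOn I I ∞ f s) :
    ContDiffOn ℝ ∞ (I ∘ f ∘ I.symm) (I.symm ⁻¹' s ∩ range I) := by
  rintro _ ⟨hu, ⟨u, rfl⟩⟩
  rw [mem_preimage, I.left_inv] at hu
  have h := (contMDiffWithinAt_iff.1 (hf u hu)).2
  simpa only [chartAt_self_eq, mfld_simps] using h

theorem isManifold_of_localInverse_comp [IsManifold I ∞ V] (hq : IsLocalHomeomorph q)
    (hg : Function.RightInverse g q)
    (h : ∀ w x, q x ∈ (hq.localInverseAt w).source →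
      IsLocalDiffeomorphAt I I ∞ (hq.localInverseAt w ∘ q) x) :
    letI : ChartedSpace H Q := hq.chartedSpaceOfRightInverse hg
    IsManifold I ∞ Q := by
  let : ChartedSpace H Q := hq.chartedSpaceOfRightInverse hg
  refine isManifold_of_contDiffOn I ∞ Q ?_
  rintro _ _ ⟨a, rfl⟩ ⟨b, rfl⟩
  refine contDiffOn_of_contMDiffOn_model fun u hu => ?_
  simp only [mfld_simps] at hu
  obtain ⟨⟨hu, -⟩, hu', hu''⟩ := hu
  simp only [mfld_simps]
  rw [hq.localInverseAt_symm] at hu' hu'' ⊢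
  have h₁ := (contMDiffOn_chart_symm (I := I) (n := ∞) u hu).contMDiffAt
    ((chartAt H (g a)).open_target.mem_nhds hu)
  have h₂ := (contMDiffOn_chart (I := I) (n := ∞) _ hu'').contMDiffAt
    ((chartAt H (g b)).open_source.mem_nhds hu'')
  have h₃ := ContMDiffAt.comp (f := hq.localInverseAt (g b) ∘ q) ((chartAt H (g a)).symm u) h₂
    (h _ _ hu').contMDiffAt
  exact (h₃.comp u h₁).contMDiffWithinAt

theorem isLocalDiffeomorph_of_localInverse_comp [IsManifold I ∞ V] (hq : IsLocalHomeomorph q)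
    (hg : Function.RightInverse g q)
    (h : ∀ w x, q x ∈ (hq.localInverseAt w).source →
      IsLocalDiffeomorphAt I I ∞ (hq.localInverseAt w ∘ q) x) :
    letI : ChartedSpace H Q := hq.chartedSpaceOfRightInverse hg
    IsLocalDiffeomorph I I ∞ q := by
  let : ChartedSpace H Q := hq.chartedSpaceOfRightInverse hg
  have := isManifold_of_localInverse_comp hq hg h
  intro x
  let s := hq.localInverseAt (g (q x))
  have mem_source : q x ∈ s.source := by
    simpa only [hg (q x)] using hq.apply_self_mem_localInverseAt_source (x := g (q x))
  have s_apply : s (q x) = g (q x) := by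
    simpa only [hg (q x)] using hq.localInverseAt_apply_self (x := g (q x))
  have hs : IsLocalDiffeomorphAt I I ∞ s (q x) := by
    refine isLocalDiffeomorphAt_of_comp_left (g := chartAt H (g (q x))) ?_
      (isLocalDiffeomorphAt_chartAt (I := I) (q x)) (s.continuousAt mem_source)
    rw [s_apply]
    exact isLocalDiffeomorphAt_chartAt _
  exact isLocalDiffeomorphAt_of_comp_left hs (h _ _ mem_source) hq.continuous.continuousAt

end LocalHomeomorph

/-- Data for gluing an oriented manifold `V` to itself: an open subset of `V`, given as the image of
the embedding `emb` of the manifold `P`, and a fixed-point-free involution `flip` of this subset,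
both preserving the orientations `oP` and `o`. A point is to be glued to its image under the
involution; the last condition makes the result a Hausdorff space. -/
structure SelfGluing {n : ℕ} {E H : Type*} [NormedAddCommGroup E] [NormedSpace ℝ E]
    [TopologicalSpace H] (I : ModelWithCorners ℝ E H) {V P : Type*} [TopologicalSpace V]
    [ChartedSpace H V] [TopologicalSpace P] [ChartedSpace H P] (o : V → Orientation ℝ E (Fin n))
    (oP : P → Orientation ℝ E (Fin n)) where
  emb : P → V
  flip : P → P
  emb_injective : Function.Injective emb
  flip_involutive : Function.Involutive flip
  flip_ne : ∀ z, flip z ≠ z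
  emb_oriented : ∀ z, OrientedAt I oP o emb z
  flip_oriented : ∀ z, OrientedAt I oP oP flip z
  isClosed_graph : IsClosed (range fun z => (emb z, emb (flip z)))

namespace SelfGluing

variable {n : ℕ} {E H : Type*} [NormedAddCommGroup E] [NormedSpace ℝ E] [TopologicalSpace H]
  {I : ModelWithCorners ℝ E H} {V P : Type*} [TopologicalSpace V] [ChartedSpace H V]
  [TopologicalSpace P] [ChartedSpace H P] {o : V → Orientation ℝ E (Fin n)}
  {oP : P → Orientation ℝ E (Fin n)} (G : SelfGluing I o oP)

/-- Two points are glued if they are equal or exchanged by the involution. -/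
def setoid : Setoid V where
  r x y := x = y ∨ (x, y) ∈ range fun z => (G.emb z, G.emb (G.flip z))
  iseqv := by
    refine ⟨fun x => Or.inl rfl, ?_, ?_⟩
    · rintro x y (rfl | ⟨z, hz⟩)
      · exact Or.inl rfl
      · obtain ⟨rfl, rfl⟩ := Prod.mk.inj hz
        exact Or.inr ⟨G.flip z, by simp only [G.flip_involutive z]⟩
    · rintro x y w (rfl | ⟨z, hz⟩) (rfl | ⟨z', hz'⟩)
      · exact Or.inl rfl
      · exact Or.inr ⟨z', hz'⟩
      · exact Or.inr ⟨z, hz⟩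
      · obtain ⟨rfl, rfl⟩ := Prod.mk.inj hz
        obtain ⟨h, rfl⟩ := Prod.mk.inj hz'
        obtain rfl := G.emb_injective h
        exact Or.inl (by rw [G.flip_involutive z])

/-- The manifold obtained from `V` by gluing. -/
def Glued : Type _ := Quotient G.setoid

instance : TopologicalSpace G.Glued := inferInstanceAs (TopologicalSpace (Quotient G.setoid))

/-- The quotient map from `V` to the manifold obtained from it by gluing. -/
def proj (x : V) : G.Glued := Quotient.mk G.setoid x

theorem proj_eq_proj_iff {x y : V} :
    G.proj x = G.proj y ↔ x = y ∨ (x, y) ∈ range fun z => (G.emb z, G.emb (G.flip z)) :=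
  Quotient.eq (r := G.setoid)

theorem proj_emb_flip (z : P) : G.proj (G.emb (G.flip z)) = G.proj (G.emb z) :=
  (G.proj_eq_proj_iff.2 (Or.inr ⟨z, rfl⟩)).symm

theorem proj_surjective : Function.Surjective G.proj := Quotient.mk_surjective

theorem continuous_proj : Continuous G.proj := continuous_quot_mk

theorem exists_orientedAt_of_proj_eq {x y : V} (h : G.proj x = G.proj y) :
    ∃ φ : V → V, φ x = y ∧ ∀ᶠ z in 𝓝 x, OrientedAt I o o φ z ∧ G.proj (φ z) = G.proj z := by
  obtain rfl | ⟨w, hw⟩ := G.proj_eq_proj_iff.1 h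
  · exact ⟨id, rfl, Eventually.of_forall fun z => ⟨orientedAt_id o z, rfl⟩⟩
  obtain ⟨rfl, rfl⟩ := Prod.mk.inj hw
  have hemb := (G.emb_oriented w).diffeo
  have inv_emb : ∀ᶠ z in 𝓝 w, hemb.localInverse ∘ G.emb =ᶠ[𝓝 z] id :=
    hemb.localInverse_eventuallyEq_left.eventuallyEq_nhds
  refine ⟨G.emb ∘ G.flip ∘ hemb.localInverse,
    congrArg (G.emb ∘ G.flip) inv_emb.self_of_nhds.eq_of_nhds, ?_⟩
  rw [← map_nhds_of_isLocalDiffeomorphAt hemb, eventually_map]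
  filter_upwards [inv_emb] with z hz
  refine ⟨(G.emb_oriented z).of_comp_right ?_, ?_⟩
  · refine ((G.emb_oriented _).comp (G.flip_oriented z)).congr ?_
    filter_upwards [hz] with z' hz'
    exact (congrArg (G.emb ∘ G.flip) hz').symm
  · exact (congrArg (G.proj ∘ G.emb ∘ G.flip) hz.eq_of_nhds).trans (G.proj_emb_flip z)

theorem isOpenMap_proj : IsOpenMap G.proj := by
  intro U hU
  refine (isQuotientMap_quotient_mk' (s := G.setoid)).isOpen_preimage.1 ?_
  rw [isOpen_iff_mem_nhds]
  rintro y ⟨u, hu, huy⟩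
  obtain ⟨φ, rfl, hφ⟩ := G.exists_orientedAt_of_proj_eq huy.symm
  have hc : ContinuousAt φ y := hφ.self_of_nhds.1.diffeo.contMDiffAt.continuousAt
  filter_upwards [hφ, hc.preimage_mem_nhds (hU.mem_nhds hu)] with z h₁ h₂
  exact ⟨φ z, h₂, h₁.2⟩

theorem not_mem_graph_self (x : V) : (x, x) ∉ range fun z => (G.emb z, G.emb (G.flip z)) := by
  rintro ⟨z, hz⟩
  obtain ⟨h, h'⟩ := Prod.mk.inj hz
  exact G.flip_ne z (G.emb_injective (h'.trans h.symm))

theorem isLocallyInjective_proj : IsLocallyInjective G.proj := by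
  intro x
  have := G.isClosed_graph.isOpen_compl.mem_nhds (G.not_mem_graph_self x)
  rw [nhds_prod_eq, mem_prod_same_iff] at this
  obtain ⟨s, hs, hsR⟩ := this
  obtain ⟨U, hUs, hU, hxU⟩ := mem_nhds_iff.1 hs
  exact ⟨U, hU, hxU, fun a ha b hb hab =>
    (G.proj_eq_proj_iff.1 hab).resolve_right (hsR ⟨hUs ha, hUs hb⟩)⟩

theorem isLocalHomeomorph_proj : IsLocalHomeomorph G.proj := by
  refine IsLocalHomeomorph.mk _ fun x => ?_
  obtain ⟨U, hU, hxU, hinj⟩ := G.isLocallyInjective_proj x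
  have : Nonempty V := ⟨x⟩
  exact ⟨OpenPartialHomeomorph.ofContinuousOpen (hinj.bijOn_image.toPartialEquiv G.proj U _)
    G.continuous_proj.continuousOn G.isOpenMap_proj hU, hxU, fun _ _ => rfl⟩

theorem localInverse_comp_proj {w x : V}
    (hx : G.proj x ∈ (G.isLocalHomeomorph_proj.localInverseAt w).source) :
    IsLocalDiffeomorphAt I I ∞ (G.isLocalHomeomorph_proj.localInverseAt w ∘ G.proj) x := by
  let s := G.isLocalHomeomorph_proj.localInverseAt w
  obtain ⟨φ, hφx, hφ⟩ := G.exists_orientedAt_of_proj_eq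
    (G.isLocalHomeomorph_proj.apply_localInverseAt_of_mem hx).symm
  have hφ₀ := hφ.self_of_nhds.1.diffeo
  refine isLocalDiffeomorphAt_congr hφ₀ ?_
  have mem_target : ∀ᶠ z in 𝓝 x, φ z ∈ s.target := by
    refine hφ₀.contMDiffAt.continuousAt.eventually (s.open_target.mem_nhds ?_)
    rw [hφx]
    exact s.map_source hx
  filter_upwards [hφ, mem_target] with z hz hz'
  have := s.right_inv hz'
  rw [G.isLocalHomeomorph_proj.localInverseAt_symm, hz.2] at this
  exact this.symm

instance : ChartedSpace H G.Glued :=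
  G.isLocalHomeomorph_proj.chartedSpaceOfRightInverse
    (Function.rightInverse_surjInv G.proj_surjective)

instance [IsManifold I ∞ V] : IsManifold I ∞ G.Glued :=
  isManifold_of_localInverse_comp _ _ fun _ _ => G.localInverse_comp_proj

theorem isLocalDiffeomorph_proj [IsManifold I ∞ V] : IsLocalDiffeomorph I I ∞ G.proj :=
  isLocalDiffeomorph_of_localInverse_comp _ _ fun _ _ => G.localInverse_comp_proj

instance [T2Space V] : T2Space G.Glued := by
  rw [t2Space_iff_of_isOpenQuotientMap ⟨G.proj_surjective, G.continuous_proj, G.isOpenMap_proj⟩]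
  have : {z : V × V | G.proj z.1 = G.proj z.2} =
      diagonal V ∪ range fun z => (G.emb z, G.emb (G.flip z)) := by
    ext z
    exact G.proj_eq_proj_iff
  rw [this]
  exact isClosed_diagonal.union G.isClosed_graph

theorem exists_pullsBack_surjInv [IsManifold I ∞ V] (z : G.Glued) :
    ∃ a : Orientation ℝ E (Fin n),
      PullsBack (derivAt I G.proj (Function.surjInv G.proj_surjective z)) a
        (o (Function.surjInv G.proj_surjective z)) :=
  exists_pullsBack_of_bijective (derivAt_bijective (G.isLocalDiffeomorph_proj _)) _

/-- The orientation of the glued manifold induced by that of `V`. -/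
def orient [IsManifold I ∞ V] (z : G.Glued) : Orientation ℝ E (Fin n) :=
  (G.exists_pullsBack_surjInv z).choose

theorem orientedAt_proj [IsManifold I ∞ V] (x : V) : OrientedAt I o G.orient G.proj x := by
  have proj_surjInv (z) := Function.surjInv_eq G.proj_surjective z
  obtain ⟨φ, hφx, hφ⟩ := G.exists_orientedAt_of_proj_eq (proj_surjInv (G.proj x)).symm
  have h : OrientedAt I o G.orient G.proj (φ x) := by
    refine ⟨G.isLocalDiffeomorph_proj _, ?_⟩
    rw [hφx, proj_surjInv]
    exact (G.exists_pullsBack_surjInv _).choose_spec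
  exact (h.comp hφ.self_of_nhds.1).congr (hφ.mono fun _ hz => hz.2)

theorem contOrientAt_orient [FiniteDimensional ℝ E] [IsManifold I ∞ V]
    (hn : Module.finrank ℝ E = n) (ho : ∀ x, ContOrientAt I o x) (z : G.Glued) :
    ContOrientAt I G.orient z := by
  have : IsManifold I 1 V := IsManifold.of_le (n := ∞) (by simp)
  have : IsManifold I 1 G.Glued := IsManifold.of_le (n := ∞) (by simp)
  obtain ⟨x, rfl⟩ := G.proj_surjective z
  exact (ho x).map hn (Eventually.of_forall G.orientedAt_proj)

/-- The map from the glued manifold induced by a map from `V` that is compatible with the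
gluing. -/
def lift {A : Type*} [TopologicalSpace A] (f : C(V, A))
    (hf : ∀ z, f (G.emb (G.flip z)) = f (G.emb z)) : C(G.Glued, A) where
  toFun := Quotient.lift f (by
    rintro x y (rfl | ⟨z, hz⟩)
    · rfl
    · obtain ⟨rfl, rfl⟩ := Prod.mk.inj hz
      exact (hf z).symm)
  continuous_toFun := f.continuous.quotient_lift _

end SelfGluing

/-! ### The half-line -/

section HalfLine

/-- The coordinate of a point of the half-line. -/
def halfCoord (t : EuclideanHalfSpace 1) : ℝ := t.1 0

/-- The point of the half-line with coordinate `max r 0`. -/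
def mkHalf (r : ℝ) : EuclideanHalfSpace 1 := ⟨WithLp.toLp 2 fun _ => max r 0, le_max_right _ _⟩

theorem continuous_halfCoord : Continuous halfCoord := by
  unfold halfCoord
  fun_prop

theorem continuous_mkHalf : Continuous mkHalf := by
  refine Continuous.subtype_mk ?_ _
  fun_prop

theorem halfCoord_nonneg (t : EuclideanHalfSpace 1) : 0 ≤ halfCoord t := t.2

@[simp]
theorem halfCoord_mkHalf (r : ℝ) : halfCoord (mkHalf r) = max r 0 := rfl

@[simp]
theorem halfCoord_zero : halfCoord 0 = 0 := rfl

theorem halfCoord_injective : Function.Injective halfCoord := by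
  intro s t h
  refine EuclideanHalfSpace.ext _ _ ?_
  ext i
  rw [Subsingleton.elim i 0]
  exact h

theorem mkHalf_halfCoord (t : EuclideanHalfSpace 1) : mkHalf (halfCoord t) = t :=
  halfCoord_injective (by simp [halfCoord_nonneg])

theorem mkHalf_zero : mkHalf 0 = 0 := halfCoord_injective (by simp)

theorem tendsto_halfCoord (t : EuclideanHalfSpace 1) :
    Tendsto halfCoord (𝓝 t) (𝓝[Ici 0] (halfCoord t)) :=
  tendsto_nhdsWithin_iff.2
    ⟨continuous_halfCoord.continuousAt, Eventually.of_forall halfCoord_nonneg⟩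

/-- The self-map of the half-line given by a real function. -/
def halfMap (φ : ℝ → ℝ) (t : EuclideanHalfSpace 1) : EuclideanHalfSpace 1 :=
  mkHalf (φ (halfCoord t))

theorem halfMap_eventuallyEq {φ : ℝ → ℝ} {t : EuclideanHalfSpace 1}
    (h : ∀ᶠ s in 𝓝[Ici 0] (halfCoord t), 0 ≤ φ s) :
    (𝓡∂ 1) ∘ halfMap φ ∘ (𝓡∂ 1).symm =ᶠ[𝓝[range (𝓡∂ 1)] ((𝓡∂ 1) t)]
      fun y => φ (y 0) • EuclideanSpace.single (0 : Fin 1) (1 : ℝ) := by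
  have ht : Tendsto (fun y : EuclideanSpace ℝ (Fin 1) => y 0) (𝓝[range (𝓡∂ 1)] ((𝓡∂ 1) t))
      (𝓝[Ici 0] (halfCoord t)) := by
    refine tendsto_nhdsWithin_iff.2 ⟨?_, ?_⟩
    · have : Continuous fun y : EuclideanSpace ℝ (Fin 1) => y 0 := by fun_prop
      exact (this.tendsto _).mono_left nhdsWithin_le_nhds
    · filter_upwards [self_mem_nhdsWithin] with y hy
      rwa [range_modelWithCornersEuclideanHalfSpace] at hy
  filter_upwards [ht.eventually h, self_mem_nhdsWithin] with y hy hy'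
  obtain ⟨s, rfl⟩ := hy'
  ext i
  rw [Subsingleton.elim i 0]
  simp only [Function.comp_apply, ModelWithCorners.left_inv]
  change max (φ (halfCoord s)) 0 = _
  rw [max_eq_left (show 0 ≤ φ (halfCoord s) from hy)]
  simp [halfCoord]

theorem continuousAt_halfMap {φ : ℝ → ℝ} {t : EuclideanHalfSpace 1}
    (h : ContinuousAt φ (halfCoord t)) : ContinuousAt (halfMap φ) t :=
  continuous_mkHalf.continuousAt.comp
    (ContinuousAt.comp (f := halfCoord) h continuous_halfCoord.continuousAt)

theorem contMDiffAt_halfMap {φ : ℝ → ℝ} {t : EuclideanHalfSpace 1}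
    (hφ : ContDiffAt ℝ ∞ φ (halfCoord t)) (h : ∀ᶠ s in 𝓝[Ici 0] (halfCoord t), 0 ≤ φ s) :
    ContMDiffAt (𝓡∂ 1) (𝓡∂ 1) ∞ (halfMap φ) t := by
  rw [contMDiffAt_iff]
  refine ⟨continuousAt_halfMap hφ.continuousAt, ?_⟩
  simp only [mfld_simps]
  have e := halfMap_eventuallyEq h
  refine ContDiffWithinAt.congr_of_eventuallyEq ?_ e (e.eq_of_nhdsWithin (mem_range_self t))
  refine ContDiffAt.contDiffWithinAt ?_
  have h₁ : ContDiffAt ℝ ∞ (fun y : EuclideanSpace ℝ (Fin 1) => y 0) ((𝓡∂ 1) t) := by fun_prop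
  have h₂ : ContDiffAt ℝ ∞ (fun y : EuclideanSpace ℝ (Fin 1) => φ (y 0)) ((𝓡∂ 1) t) :=
    ContDiffAt.comp ((𝓡∂ 1) t) hφ h₁
  exact h₂.smul contDiffAt_const

/-- The map `θ` is a local diffeomorphism of the half-line at `t`, with derivative `a`. -/
structure HalfDiffeoAt (θ : EuclideanHalfSpace 1 → EuclideanHalfSpace 1) (a : ℝ)
    (t : EuclideanHalfSpace 1) : Prop where
  diffeo : IsLocalDiffeomorphAt (𝓡∂ 1) (𝓡∂ 1) ∞ θ t
  deriv : HasMFDerivAt (𝓡∂ 1) (𝓡∂ 1) θ t (a • ContinuousLinearMap.id ℝ (EuclideanSpace ℝ (Fin 1)))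

theorem hasMFDerivAt_halfMap {φ : ℝ → ℝ} {a : ℝ} {t : EuclideanHalfSpace 1}
    (hφ : HasDerivAt φ a (halfCoord t)) (h : ∀ᶠ s in 𝓝[Ici 0] (halfCoord t), 0 ≤ φ s) :
    HasMFDerivAt (𝓡∂ 1) (𝓡∂ 1) (halfMap φ) t
      (a • ContinuousLinearMap.id ℝ (EuclideanSpace ℝ (Fin 1))) := by
  refine ⟨continuousAt_halfMap hφ.continuousAt, ?_⟩
  have e := halfMap_eventuallyEq h
  let π : EuclideanSpace ℝ (Fin 1) →L[ℝ] ℝ := EuclideanSpace.proj 0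
  have deriv_comp := (HasDerivAt.comp_hasFDerivAt (f := π) ((𝓡∂ 1) t) hφ π.hasFDerivAt).smul_const
    (EuclideanSpace.single (0 : Fin 1) (1 : ℝ))
  have smulRight_eq : (a • π).smulRight (EuclideanSpace.single (0 : Fin 1) (1 : ℝ)) =
      a • ContinuousLinearMap.id ℝ (EuclideanSpace ℝ (Fin 1)) := by
    ext v i
    rw [Subsingleton.elim i 0]
    simp [π]
  rw [smulRight_eq] at deriv_comp
  exact deriv_comp.hasFDerivWithinAt.congr_of_eventuallyEq e
    (e.eq_of_nhdsWithin (mem_range_self t))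

theorem halfDiffeoAt_halfMap {φ ψ : ℝ → ℝ} {a : ℝ} {t : EuclideanHalfSpace 1}
    (ha : HasDerivAt φ a (halfCoord t))
    (hφ : ∀ᶠ s in 𝓝[Ici 0] (halfCoord t), ContDiffAt ℝ ∞ φ s ∧ 0 ≤ φ s ∧ ψ (φ s) = s)
    (hψ : ∀ᶠ s in 𝓝[Ici 0] (φ (halfCoord t)), ContDiffAt ℝ ∞ ψ s ∧ 0 ≤ ψ s ∧ φ (ψ s) = s) :
    HalfDiffeoAt (halfMap φ) a t where
  diffeo := by
    have h₀ : halfCoord (halfMap φ t) = φ (halfCoord t) :=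
      max_eq_left (hφ.self_of_nhdsWithin (halfCoord_nonneg t)).2.1
    rw [← h₀] at hψ
    refine isLocalDiffeomorphAt_of_eventually (g := halfMap ψ) ?_ ?_
    · filter_upwards [(tendsto_halfCoord t).eventually (eventually_eventually_nhdsWithin.2 hφ)]
        with s hs
      have h₁ := hs.self_of_nhdsWithin (halfCoord_nonneg s)
      refine ⟨contMDiffAt_halfMap h₁.1 (hs.mono fun _ h => h.2.1), halfCoord_injective ?_⟩
      simp [halfMap, h₁.2.1, h₁.2.2, halfCoord_nonneg]
    · filter_upwards [(tendsto_halfCoord _).eventually (eventually_eventually_nhdsWithin.2 hψ)]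
        with s hs
      have h₁ := hs.self_of_nhdsWithin (halfCoord_nonneg s)
      refine ⟨contMDiffAt_halfMap h₁.1 (hs.mono fun _ h => h.2.1), halfCoord_injective ?_⟩
      simp [halfMap, h₁.2.1, h₁.2.2, halfCoord_nonneg]
  deriv := hasMFDerivAt_halfMap ha (hφ.mono fun _ h => h.2.1)

theorem halfDiffeoAt_id (t : EuclideanHalfSpace 1) : HalfDiffeoAt id 1 t where
  diffeo := isLocalDiffeomorphAt_id t
  deriv := by
    rw [one_smul]
    exact hasMFDerivAt_id t

instance : T2Space (EuclideanHalfSpace 1) :=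
  T2Space.of_injective_continuous halfCoord_injective continuous_halfCoord

theorem isCompact_halfCoord_le (r : ℝ) :
    IsCompact {t : EuclideanHalfSpace 1 | halfCoord t ≤ r} := by
  refine ((isCompact_Icc (a := (0 : ℝ)) (b := r)).image continuous_mkHalf).of_isClosed_subset
    (isClosed_le continuous_halfCoord continuous_const) fun t ht => ?_
  exact ⟨halfCoord t, ⟨halfCoord_nonneg t, ht⟩, mkHalf_halfCoord t⟩

/-- The diffeomorphism `t ↦ t / (1 + t)` of the half-line onto `[0, 1)`. -/
def shrink : EuclideanHalfSpace 1 → EuclideanHalfSpace 1 := halfMap fun t => t / (1 + t)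

/-- The involution `t ↦ 1 / t` of the open half-line, extended by the junk value `0` at `0`. -/
def halfInv : EuclideanHalfSpace 1 → EuclideanHalfSpace 1 := halfMap fun t => t⁻¹

theorem halfCoord_shrink (t : EuclideanHalfSpace 1) :
    halfCoord (shrink t) = halfCoord t / (1 + halfCoord t) := by
  have := halfCoord_nonneg t
  exact max_eq_left (by positivity)

theorem halfCoord_halfInv (t : EuclideanHalfSpace 1) :
    halfCoord (halfInv t) = (halfCoord t)⁻¹ :=
  max_eq_left (inv_nonneg.2 (halfCoord_nonneg t))

theorem halfInv_involutive : Function.Involutive halfInv := fun t =>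
  halfCoord_injective (by rw [halfCoord_halfInv, halfCoord_halfInv, inv_inv])

theorem shrink_zero : shrink 0 = 0 :=
  halfCoord_injective (by rw [halfCoord_shrink, halfCoord_zero, zero_div])

theorem halfCoord_shrink_lt_one (t : EuclideanHalfSpace 1) : halfCoord (shrink t) < 1 := by
  have := halfCoord_nonneg t
  rw [halfCoord_shrink, div_lt_one (by positivity)]
  linarith

theorem halfCoord_shrink_pos {t : EuclideanHalfSpace 1} (ht : 0 < halfCoord t) :
    0 < halfCoord (shrink t) := by
  rw [halfCoord_shrink]
  positivity

theorem shrink_injective : Function.Injective shrink := by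
  intro s t h
  have h' := congrArg halfCoord h
  have hs := halfCoord_nonneg s
  have ht := halfCoord_nonneg t
  rw [halfCoord_shrink, halfCoord_shrink, div_eq_div_iff (by positivity) (by positivity)] at h'
  exact halfCoord_injective (by linarith)

theorem halfCoord_shrink_halfInv {t : EuclideanHalfSpace 1} (ht : 0 < halfCoord t) :
    halfCoord (shrink (halfInv t)) = 1 - halfCoord (shrink t) := by
  rw [halfCoord_shrink, halfCoord_shrink, halfCoord_halfInv]
  field_simp
  ring

theorem exists_shrink_eq {t : EuclideanHalfSpace 1} (h₀ : 0 < halfCoord t) (h₁ : halfCoord t < 1) :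
    ∃ s, 0 < halfCoord s ∧ shrink s = t := by
  have hpos : 0 < halfCoord t / (1 - halfCoord t) := div_pos h₀ (sub_pos.2 h₁)
  refine ⟨mkHalf (halfCoord t / (1 - halfCoord t)), by simpa using hpos, halfCoord_injective ?_⟩
  rw [halfCoord_shrink, halfCoord_mkHalf, max_eq_left hpos.le]
  have : 1 - halfCoord t ≠ 0 := (sub_pos.2 h₁).ne'
  field_simp
  ring

theorem halfDiffeoAt_shrink (t : EuclideanHalfSpace 1) :
    ∃ a, 0 < a ∧ HalfDiffeoAt shrink a t := by
  have ht := halfCoord_nonneg t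
  refine ⟨1 / (1 + halfCoord t) ^ 2, by positivity, halfDiffeoAt_halfMap (ψ := fun s => s / (1 - s))
    ?_ ?_ ?_⟩
  · have h := (hasDerivAt_id (halfCoord t)).div ((hasDerivAt_id (halfCoord t)).const_add 1)
      (show 1 + id (halfCoord t) ≠ 0 by simp only [id]; positivity)
    have e : (1 * (1 + id (halfCoord t)) - id (halfCoord t) * 1) / (1 + id (halfCoord t)) ^ 2 =
        1 / (1 + halfCoord t) ^ 2 := by simp only [id]; ring
    rw [← e]
    exact h
  · filter_upwards [self_mem_nhdsWithin] with s hs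
    have hs' : (0 : ℝ) ≤ s := hs
    have hne : 1 + s ≠ 0 := by positivity
    refine ⟨contDiffAt_id.div (contDiffAt_const.add contDiffAt_id) hne, by positivity, ?_⟩
    field_simp
    ring
  · have h1 : halfCoord t / (1 + halfCoord t) < 1 := by
      rw [div_lt_one (by positivity)]
      linarith
    filter_upwards [self_mem_nhdsWithin, nhdsWithin_le_nhds (Iio_mem_nhds h1)] with s hs hs1
    have hs' : (0 : ℝ) ≤ s := hs
    have hs1' : 0 < 1 - s := sub_pos.2 hs1
    refine ⟨contDiffAt_id.div (contDiffAt_const.sub contDiffAt_id) hs1'.ne', by positivity, ?_⟩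
    have : 1 + s / (1 - s) = 1 / (1 - s) := by field_simp; ring
    rw [this]
    field_simp

theorem halfDiffeoAt_halfInv {t : EuclideanHalfSpace 1} (ht : 0 < halfCoord t) :
    ∃ a, a < 0 ∧ HalfDiffeoAt halfInv a t := by
  have key (r : ℝ) (hr : 0 < r) : ∀ᶠ s in 𝓝[Ici 0] r,
      ContDiffAt ℝ ∞ (fun s : ℝ => s⁻¹) s ∧ 0 ≤ s⁻¹ ∧ s⁻¹⁻¹ = s := by
    filter_upwards [nhdsWithin_le_nhds (Ioi_mem_nhds hr)] with s hs
    have hs' : 0 < s := hs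
    exact ⟨contDiffAt_inv ℝ hs'.ne', by positivity, inv_inv s⟩
  refine ⟨-(halfCoord t ^ 2)⁻¹, neg_neg_iff_pos.2 (by positivity),
    halfDiffeoAt_halfMap (ψ := fun s => s⁻¹) (hasDerivAt_inv ht.ne') (key _ ht)
      (key _ (by positivity))⟩

end HalfLine

/-! ### Products with the half-line -/

section HalfProduct

variable {p : ℕ} {M N : Type*} [TopologicalSpace M] [ChartedSpace (EuclideanSpace ℝ (Fin p)) M]
  [TopologicalSpace N] [ChartedSpace (EuclideanSpace ℝ (Fin p)) N]

/-- The orientation of `M × [0, ∞)` whose boundary orientation is `o`. -/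
def prodOrient (o : M → Orientation ℝ (EuclideanSpace ℝ (Fin p)) (Fin p)) :
    M × EuclideanHalfSpace 1 → Orientation ℝ (HalfSpaceVec p) (Fin (p + 1)) :=
  fun z => outwardFirst (o z.1)

variable {o : M → Orientation ℝ (EuclideanSpace ℝ (Fin p)) (Fin p)}
  {o' : N → Orientation ℝ (EuclideanSpace ℝ (Fin p)) (Fin p)} {φ : M → N}
  {θ : EuclideanHalfSpace 1 → EuclideanHalfSpace 1} {a : ℝ} {x : M} {t : EuclideanHalfSpace 1}

theorem derivAt_prodMap (hφ : IsLocalDiffeomorphAt (𝓡 p) (𝓡 p) ∞ φ x) (hθ : HalfDiffeoAt θ a t)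
    (v : EuclideanSpace ℝ (Fin p)) (w : EuclideanSpace ℝ (Fin 1)) :
    derivAt (halfModel p) (Prod.map φ θ) (x, t) (v, w) = (derivAt (𝓡 p) φ x v, a • w) := by
  have h₁ := (hφ.mdifferentiableAt (by simp)).hasMFDerivAt
  have h := HasMFDerivAt.prodMap (p := (x, t)) h₁ hθ.deriv
  rw [derivAt, h.mfderiv]
  exact Prod.ext rfl (congrArg (fun A => A w) hθ.deriv.mfderiv)

theorem OrientedAt.prodMap_pos (hφ : OrientedAt (𝓡 p) o o' φ x) (hθ : HalfDiffeoAt θ a t)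
    (ha : 0 < a) :
    OrientedAt (halfModel p) (prodOrient o) (prodOrient o') (Prod.map φ θ) (x, t) where
  diffeo := isLocalDiffeomorphAt_prodMap hφ.diffeo hθ.diffeo
  pullsBack := hφ.pullsBack.outwardFirst_of_pos ha (derivAt_prodMap hφ.diffeo hθ)

theorem OrientedAt.prodMap_neg (hφ : OrientedAt (𝓡 p) (fun y => -o y) o' φ x)
    (hθ : HalfDiffeoAt θ a t) (ha : a < 0) :
    OrientedAt (halfModel p) (prodOrient o) (prodOrient o') (Prod.map φ θ) (x, t) where
  diffeo := isLocalDiffeomorphAt_prodMap hφ.diffeo hθ.diffeo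
  pullsBack := hφ.pullsBack.outwardFirst_of_neg ha (derivAt_prodMap hφ.diffeo hθ)

theorem chartEnd_prod [IsManifold (𝓡 p) ∞ M] {x₀ : M} {t₀ : EuclideanHalfSpace 1}
    (hx : x ∈ (chartAt (EuclideanSpace ℝ (Fin p)) x₀).source)
    (v : EuclideanSpace ℝ (Fin p)) (w : EuclideanSpace ℝ (Fin 1)) :
    chartEnd (halfModel p) (x₀, t₀) (x, t) (v, w) = (chartEnd (𝓡 p) x₀ x v, (1 : ℝ) • w) := by
  have : IsManifold (𝓡 p) 1 M := IsManifold.of_le (n := ∞) (by simp)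
  have deriv_fst := (mdifferentiableAt_extChartAt (I := 𝓡 p) hx).hasMFDerivAt
  have deriv_snd : HasMFDerivAt (𝓡∂ 1) 𝓘(ℝ, EuclideanSpace ℝ (Fin 1)) (extChartAt (𝓡∂ 1) t₀) t
      (ContinuousLinearMap.id ℝ (EuclideanSpace ℝ (Fin 1))) := by
    have h := (mdifferentiableAt_extChartAt (I := 𝓡∂ 1) (mem_chart_source _ t)).hasMFDerivAt
    rwa [mfderiv_extChartAt_self] at h
  have deriv_prod : HasMFDerivAt (halfModel p) 𝓘(ℝ, HalfSpaceVec p)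
      (extChartAt (halfModel p) (x₀, t₀)) (x, t)
      ((mfderiv (𝓡 p) 𝓘(ℝ, EuclideanSpace ℝ (Fin p)) (extChartAt (𝓡 p) x₀) x :
        EuclideanSpace ℝ (Fin p) →L[ℝ] EuclideanSpace ℝ (Fin p)).prodMap
        (ContinuousLinearMap.id ℝ (EuclideanSpace ℝ (Fin 1)))) := by
    rw [extChartAt_prod, modelWithCornersSelf_prod, ← chartedSpaceSelf_prod]
    exact (deriv_fst.comp (x, t) (hasMFDerivAt_fst (I' := 𝓡∂ 1) (x, t))).prodMk
      (deriv_snd.comp (x, t) (hasMFDerivAt_snd (I := 𝓡 p) (x, t)))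
  rw [one_smul]
  exact congrArg (fun A : HalfSpaceVec p →L[ℝ] HalfSpaceVec p => A (v, w)) deriv_prod.mfderiv

theorem ContOrientAt.prodOrient [IsManifold (𝓡 p) ∞ M] (h : ContOrientAt (𝓡 p) o x) :
    ContOrientAt (halfModel p) (prodOrient o) (x, t) := by
  obtain ⟨a, ha⟩ := h
  refine ⟨outwardFirst a, ?_⟩
  rw [nhds_prod_eq]
  filter_upwards [(ha.and (chart_source_mem_nhds (EuclideanSpace ℝ (Fin p)) x)).prod_inl (𝓝 t)]
  rintro ⟨y, s⟩ ⟨hy, hy_mem⟩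
  exact hy.outwardFirst_of_pos one_pos (chartEnd_prod hy_mem)

theorem isBoundaryPoint_prod_half {z : M × EuclideanHalfSpace 1} :
    (halfModel p).IsBoundaryPoint z ↔ z.2 = 0 := by
  have boundary_prod : z ∈ (halfModel p).boundary (M × EuclideanHalfSpace 1) ↔
      z.2 ∈ (𝓡∂ 1).boundary (EuclideanHalfSpace 1) := by
    rw [ModelWithCorners.boundary_of_boundaryless_left]
    exact ⟨fun h => h.2, fun h => ⟨trivial, h⟩⟩
  have boundary_half : z.2 ∈ (𝓡∂ 1).boundary (EuclideanHalfSpace 1) ↔ 0 = halfCoord z.2 := by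
    change extChartAt (𝓡∂ 1) z.2 z.2 ∈ frontier (range (𝓡∂ 1)) ↔ _
    rw [frontier_range_modelWithCornersEuclideanHalfSpace]
    rfl
  rw [← halfCoord_injective.eq_iff, halfCoord_zero, eq_comm]
  exact boundary_prod.trans boundary_half

end HalfProduct

/-! ### Oriented closed manifolds and fillings -/

section Fillings

variable {p : ℕ}

theorem finrank_halfSpaceVec : Module.finrank ℝ (HalfSpaceVec p) = p + 1 := by
  rw [Module.finrank_prod, finrank_euclideanSpace_fin, finrank_euclideanSpace_fin]

/-- The orientation of a closed manifold, with values in the orientations of the model space. -/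
def ClosedManifold.or (N : ClosedManifold p) :
    N.carrier → Orientation ℝ (EuclideanSpace ℝ (Fin p)) (Fin p) :=
  N.orient

theorem ClosedManifold.contOrientAt (N : ClosedManifold p) (x : N.carrier) :
    ContOrientAt (𝓡 p) N.or x :=
  isContinuousOrientation_iff.1 N.orient_continuous x

/-- The orientation of a filling, with values in the orientations of the model space. -/
def Filling.or {N : ClosedManifold p} (W : Filling N) :
    W.carrier → Orientation ℝ (HalfSpaceVec p) (Fin (p + 1)) :=
  W.orient

theorem Filling.contOrientAt {N : ClosedManifold p} (W : Filling N) (x : W.carrier) :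
    ContOrientAt (halfModel p) W.or x :=
  isContinuousOrientation_iff.1 W.orient_continuous x

theorem Filling.collar_pullsBack_zero {N : ClosedManifold p} (W : Filling N) (x : N.carrier) :
    PullsBack (derivAt (halfModel p) W.collar (x, 0)) (W.or (W.collar (x, 0)))
      (outwardFirst (N.or x)) :=
  boundaryForm_condition_iff_pullsBack.1 (W.collar_orient x)

/- The collar is required to be oriented along the boundary only; by continuity it is oriented along
each half-line `{x} × [0, ∞)`. -/
theorem Filling.collar_oriented {N : ClosedManifold p} (W : Filling N)
    (z : N.carrier × EuclideanHalfSpace 1) :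
    OrientedAt (halfModel p) (prodOrient N.or) W.or W.collar z := by
  have hpullback := orientedAt_pullbackOrient W.collar_diffeo W.or
  have agree_zero : pullbackOrient W.collar_diffeo W.or (z.1, 0) = prodOrient N.or (z.1, 0) :=
    (hpullback (z.1, 0)).pullsBack.unique_right (W.collar_pullsBack_zero z.1)
  have hs : IsPreconnected (({z.1} : Set N.carrier) ×ˢ (univ : Set (EuclideanHalfSpace 1))) :=
    isPreconnected_singleton.prod isPreconnected_univ
  have agree := eqOn_of_contOrientAt
    (fun y => (W.contOrientAt _).comap finrank_halfSpaceVec (Eventually.of_forall hpullback))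
    (fun y => (N.contOrientAt y.1).prodOrient) hs (by simp) agree_zero
  exact ⟨W.collar_diffeo z, agree (show z ∈ _ by simp) ▸ (hpullback z).pullsBack⟩

/-- The filling given by a compact oriented manifold with an oriented collar of its boundary. -/
def Filling.ofCollar (N : ClosedManifold p) (W : Type) [TopologicalSpace W]
    [ChartedSpace (HalfSpace p) W] [IsManifold (halfModel p) ∞ W] [CompactSpace W] [T2Space W]
    (oW : W → Orientation ℝ (HalfSpaceVec p) (Fin (p + 1)))
    (hoW : ∀ x, ContOrientAt (halfModel p) oW x) (c : N.carrier × EuclideanHalfSpace 1 → W)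
    (hinj : Function.Injective c)
    (hc : ∀ z, OrientedAt (halfModel p) (prodOrient N.or) oW c z)
    (hb : range (fun x : N.carrier => c (x, 0)) = (halfModel p).boundary W) : Filling N where
  carrier := W
  orient := oW
  orient_continuous := isContinuousOrientation_iff.2 hoW
  collar := c
  collar_injective := hinj
  collar_diffeo z := (hc z).diffeo
  collar_boundary := hb
  collar_orient x := boundaryForm_condition_iff_pullsBack.2 (hc (x, 0)).pullsBack

section Sum

variable {n : ℕ} {E H : Type*} [NormedAddCommGroup E] [NormedSpace ℝ E] [TopologicalSpace H]
  {I : ModelWithCorners ℝ E H} {M N : Type*} [TopologicalSpace M] [ChartedSpace H M]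
  [TopologicalSpace N] [ChartedSpace H N]

theorem orientedAt_inl (o : M → Orientation ℝ E (Fin n)) (o' : N → Orientation ℝ E (Fin n))
    (x : M) : OrientedAt I o (Sum.elim o o') (Sum.inl : M → M ⊕ N) x where
  diffeo := isLocalDiffeomorphAt_inl x
  pullsBack := by
    rw [derivAt, (hasMFDerivAt_inl (I := I) (M' := N) (q := x) (p := Sum.inl x)).mfderiv]
    exact pullsBack_id _

theorem orientedAt_inr (o : M → Orientation ℝ E (Fin n)) (o' : N → Orientation ℝ E (Fin n))
    (x : N) : OrientedAt I o' (Sum.elim o o') (Sum.inr : N → M ⊕ N) x where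
  diffeo := isLocalDiffeomorphAt_inr x
  pullsBack := by
    rw [derivAt, (hasMFDerivAt_inr (I := I) (M := M) (q' := x) (p := Sum.inr x)).mfderiv]
    exact pullsBack_id _

theorem contOrientAt_sumElim [FiniteDimensional ℝ E] [IsManifold I ∞ M] [IsManifold I ∞ N]
    (hn : Module.finrank ℝ E = n) {o : M → Orientation ℝ E (Fin n)}
    {o' : N → Orientation ℝ E (Fin n)} (h : ∀ x, ContOrientAt I o x)
    (h' : ∀ x, ContOrientAt I o' x) (x : M ⊕ N) : ContOrientAt I (Sum.elim o o') x := by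
  rcases x with x | x
  · exact (h x).map hn (Eventually.of_forall (orientedAt_inl o o'))
  · exact (h' x).map hn (Eventually.of_forall (orientedAt_inr o o'))

end Sum

namespace ClosedManifold

variable (M N : ClosedManifold p)

/-- The inclusion of the first summand of a disjoint union. -/
def inl (x : M.carrier) : (M.sum N).carrier := Sum.inl x

/-- The inclusion of the second summand of a disjoint union. -/
def inr (x : N.carrier) : (M.sum N).carrier := Sum.inr x

theorem sum_or : (M.sum N).or = Sum.elim M.or N.or := by
  funext x
  rcases x with x | x <;> rfl

theorem inl_oriented (x : M.carrier) : OrientedAt (𝓡 p) M.or (M.sum N).or (M.inl N) x := by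
  rw [sum_or]
  exact orientedAt_inl M.or N.or x

theorem inr_oriented (x : N.carrier) : OrientedAt (𝓡 p) N.or (M.sum N).or (M.inr N) x := by
  rw [sum_or]
  exact orientedAt_inr M.or N.or x

variable {M N}

theorem sum_cases {P : (M.sum N).carrier → Prop} (inl : ∀ x, P (M.inl N x))
    (inr : ∀ x, P (M.inr N x)) (x : (M.sum N).carrier) : P x :=
  Sum.casesOn x inl inr

theorem inl_injective : Function.Injective (M.inl N) := Sum.inl_injective

theorem inr_injective : Function.Injective (M.inr N) := Sum.inr_injective

theorem inl_ne_inr (x : M.carrier) (y : N.carrier) : M.inl N x ≠ M.inr N y := Sum.inl_ne_inr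

/-- The map out of a disjoint union with given restrictions to the summands. -/
def elim {A : Type*} (f : M.carrier → A) (g : N.carrier → A) : (M.sum N).carrier → A :=
  Sum.elim f g

theorem elim_oriented {P : Type*} [TopologicalSpace P] [ChartedSpace (EuclideanSpace ℝ (Fin p)) P]
    {o : P → Orientation ℝ (EuclideanSpace ℝ (Fin p)) (Fin p)} {f : M.carrier → P}
    {g : N.carrier → P} (hf : ∀ x, OrientedAt (𝓡 p) M.or o f x)
    (hg : ∀ x, OrientedAt (𝓡 p) N.or o g x) (x : (M.sum N).carrier) :
    OrientedAt (𝓡 p) (M.sum N).or o (elim f g) x := by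
  induction x using sum_cases with
  | inl x => exact (inl_oriented M N x).of_comp_right (hf x)
  | inr x => exact (inr_oriented M N x).of_comp_right (hg x)

end ClosedManifold

/-- A fixed-point-free involution of a closed manifold that reverses the orientation. -/
structure FreeReversal (N : ClosedManifold p) where
  toFun : N.carrier → N.carrier
  involutive : Function.Involutive toFun
  ne_self : ∀ x, toFun x ≠ x
  oriented : ∀ x, OrientedAt (𝓡 p) (fun y => -N.or y) N.or toFun x

theorem FreeReversal.continuous {N : ClosedManifold p} (σ : FreeReversal N) :
    Continuous σ.toFun :=
  continuous_iff_continuousAt.2 fun x => (σ.oriented x).diffeo.contMDiffAt.continuousAt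

/-- The involution of `M ⊔ -M` that interchanges the summands. -/
def ClosedManifold.swap (M : ClosedManifold p) : FreeReversal (M.sum M.neg) where
  toFun := elim (M.inr M.neg) (M.inl M.neg)
  involutive := sum_cases (fun _ => rfl) fun _ => rfl
  ne_self := sum_cases (fun _ => Sum.inr_ne_inl) fun _ => Sum.inl_ne_inr
  oriented x := by
    induction x using sum_cases with
    | inl x => exact (inl_oriented M M.neg x).neg.of_comp_right (inr_oriented M M.neg x)
    | inr x =>
      have or_neg_neg : (fun y => -M.neg.or y) = M.or := funext fun y => neg_neg (M.or y)
      exact (inr_oriented M M.neg x).neg.of_comp_right (or_neg_neg ▸ inl_oriented M M.neg x)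

end Fillings

/-! ### Singular manifolds that bound -/

section Bounds

variable {p : ℕ} {T : Type*} [TopologicalSpace T]

/-- The singular manifold `s` is the boundary of a map from a compact oriented manifold. -/
def Bounds (s : SingularMfd p T) : Prop :=
  ∃ (W : Filling s.dom) (K : C(W.carrier, T)), ∀ x, K (W.bd x) = s.map x

/-- The singular manifold `s` with the opposite orientation of its domain. -/
def SingularMfd.neg (s : SingularMfd p T) : SingularMfd p T where
  dom := s.dom.neg
  map := s.map

theorem Bounds.congr {s t : SingularMfd p T} (h : Bounds s) (e : t.dom.carrier → s.dom.carrier)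
    (he : Function.Bijective e) (ho : ∀ x, OrientedAt (𝓡 p) t.dom.or s.dom.or e x)
    (hm : ∀ x, s.map (e x) = t.map x) : Bounds t := by
  obtain ⟨W, K, hK⟩ := h
  refine ⟨Filling.ofCollar t.dom W.carrier W.or W.contOrientAt (W.collar ∘ Prod.map e id)
    (W.collar_injective.comp (he.1.prodMap Function.injective_id)) ?_ ?_, K, ?_⟩
  · rintro ⟨x, r⟩
    exact (W.collar_oriented _).comp ((ho x).prodMap_pos (halfDiffeoAt_id r) one_pos)
  · rw [← W.collar_boundary]
    exact he.2.range_comp fun x => W.collar (x, 0)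
  · exact fun x => (hK (e x)).trans (hm x)

theorem Bounds.neg {s : SingularMfd p T} (h : Bounds s) : Bounds s.neg := by
  obtain ⟨W, K, hK⟩ := h
  refine ⟨Filling.ofCollar s.dom.neg W.carrier (fun x => -W.or x)
    (fun x => (W.contOrientAt x).neg) W.collar W.collar_injective (fun z => ?_) W.collar_boundary,
    K, hK⟩
  have prodOrient_neg : (fun y => -prodOrient s.dom.or y) = prodOrient s.dom.neg.or :=
    funext fun y => (outwardFirst_neg _).symm
  exact prodOrient_neg ▸ (W.collar_oriented z).neg

/-- The disjoint union of two fillings, as a filling of the disjoint union. -/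
def Filling.sum {M N : ClosedManifold p} (W : Filling M) (W' : Filling N) : Filling (M.sum N) :=
  Filling.ofCollar (M.sum N) (W.carrier ⊕ W'.carrier) (Sum.elim W.or W'.or)
    (contOrientAt_sumElim finrank_halfSpaceVec W.contOrientAt W'.contOrientAt)
    (fun z => ClosedManifold.elim (fun x => Sum.inl (W.collar (x, z.2)))
      (fun x => Sum.inr (W'.collar (x, z.2))) z.1)
    (by
      rintro ⟨x | x, r⟩ ⟨y | y, r'⟩ h
      · obtain ⟨rfl, rfl⟩ := Prod.mk.inj (W.collar_injective (Sum.inl_injective h))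
        rfl
      · exact absurd h Sum.inl_ne_inr
      · exact absurd h Sum.inr_ne_inl
      · obtain ⟨rfl, rfl⟩ := Prod.mk.inj (W'.collar_injective (Sum.inr_injective h))
        rfl)
    (by
      rintro ⟨x, r⟩
      induction x using ClosedManifold.sum_cases with
      | inl x =>
        have hinl := (ClosedManifold.inl_oriented M N x).prodMap_pos (halfDiffeoAt_id r) one_pos
        exact hinl.of_comp_right ((orientedAt_inl W.or W'.or _).comp (W.collar_oriented (x, r)))
      | inr x =>
        have hinr := (ClosedManifold.inr_oriented M N x).prodMap_pos (halfDiffeoAt_id r) one_pos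
        exact hinr.of_comp_right ((orientedAt_inr W.or W'.or _).comp (W'.collar_oriented (x, r))))
    (by
      rw [ModelWithCorners.boundary_disjointUnion, ← W.collar_boundary, ← W'.collar_boundary,
        ← range_comp, ← range_comp]
      exact Sum.elim_range (fun x => (Sum.inl (W.collar (x, 0)) : W.carrier ⊕ W'.carrier))
        (fun x => Sum.inr (W'.collar (x, 0))))

theorem Bounds.sum {s t : SingularMfd p T} (hs : Bounds s) (ht : Bounds t) :
    Bounds (s.sum t) := by
  obtain ⟨W, K, hK⟩ := hs
  obtain ⟨W', K', hK'⟩ := ht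
  exact ⟨W.sum W', ⟨Sum.elim K K', K.continuous.sumElim K'.continuous⟩,
    ClosedManifold.sum_cases hK hK'⟩

end Bounds

/-! ### Fillings obtained by gluing -/

namespace SelfGluing

variable {n : ℕ} {E H : Type*} [NormedAddCommGroup E] [NormedSpace ℝ E] [TopologicalSpace H]
  {I : ModelWithCorners ℝ E H} {V P : Type*} [TopologicalSpace V] [ChartedSpace H V]
  [TopologicalSpace P] [ChartedSpace H P] {o : V → Orientation ℝ E (Fin n)}
  {oP : P → Orientation ℝ E (Fin n)} (G : SelfGluing I o oP)

theorem compactSpace_glued {C : Set V} (hC : IsCompact C)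
    (h : ∀ x ∉ C, ∃ z, G.emb z = x ∧ G.emb (G.flip z) ∈ C) : CompactSpace G.Glued := by
  have image_eq_univ : G.proj '' C = univ := by
    refine eq_univ_of_forall fun y => ?_
    obtain ⟨x, rfl⟩ := G.proj_surjective y
    by_cases hx : x ∈ C
    · exact ⟨x, hx, rfl⟩
    · obtain ⟨z, rfl, hz⟩ := h x hx
      exact ⟨_, hz, G.proj_emb_flip z⟩
  exact ⟨image_eq_univ ▸ hC.image G.continuous_proj⟩

theorem proj_comp_injective {A : Type*} {c : A → V} (hc : Function.Injective c)
    (h : ∀ z, G.emb z ∈ range c → G.emb (G.flip z) ∉ range c) :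
    Function.Injective (G.proj ∘ c) := by
  intro a b hab
  rcases G.proj_eq_proj_iff.1 hab with hab | ⟨z, hz⟩
  · exact hc hab
  · obtain ⟨ha, hb⟩ := Prod.mk.inj hz
    exact absurd ⟨b, hb.symm⟩ (h z ⟨a, ha.symm⟩)

theorem proj_mem_boundary_iff [IsManifold I ∞ V] {x : V} :
    G.proj x ∈ I.boundary G.Glued ↔ x ∈ I.boundary V :=
  ((G.isLocalDiffeomorph_proj x).isBoundaryPoint_iff (by simp)).symm

end SelfGluing

section Opens

variable {n : ℕ} {E H : Type*} [NormedAddCommGroup E] [NormedSpace ℝ E] [TopologicalSpace H]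
  {I : ModelWithCorners ℝ E H} {P W : Type*} [TopologicalSpace P] [ChartedSpace H P]
  [TopologicalSpace W] [ChartedSpace H W]

/-- The orientation of an open subset `U` of an oriented manifold. -/
def restrictOrient (I : ModelWithCorners ℝ E H) (U : TopologicalSpace.Opens W)
    (o : W → Orientation ℝ E (Fin n)) : U → Orientation ℝ E (Fin n) :=
  pullbackOrient (isLocalDiffeomorphAt_subtypeVal (I := I) U) o

theorem orientedAt_subtypeVal (U : TopologicalSpace.Opens W) (o : W → Orientation ℝ E (Fin n))
    (x : U) : OrientedAt I (restrictOrient I U o) o Subtype.val x :=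
  orientedAt_pullbackOrient _ o x

theorem OrientedAt.of_subtypeVal_comp {U : TopologicalSpace.Opens W}
    {oP : P → Orientation ℝ E (Fin n)} {o : W → Orientation ℝ E (Fin n)} {φ : P → U} {z : P}
    (h : OrientedAt I oP o (Subtype.val ∘ φ) z) : OrientedAt I oP (restrictOrient I U o) φ z :=
  (orientedAt_subtypeVal U o (φ z)).of_comp_left h
    (Topology.IsInducing.subtypeVal.continuousAt_iff.2 h.diffeo.contMDiffAt.continuousAt)

end Opens

section Neck

variable {p : ℕ}

/-- The open manifold `N × (0, ∞)`, as an open subset of `N × [0, ∞)`. -/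
def neck (N : ClosedManifold p) : TopologicalSpace.Opens (N.carrier × EuclideanHalfSpace 1) :=
  ⟨{z | 0 < halfCoord z.2}, isOpen_lt continuous_const (continuous_halfCoord.comp continuous_snd)⟩

/-- The product orientation of `N × (0, ∞)`. -/
def neckOrient (N : ClosedManifold p) : neck N → Orientation ℝ (HalfSpaceVec p) (Fin (p + 1)) :=
  restrictOrient (halfModel p) (neck N) (prodOrient N.or)

variable {N : ClosedManifold p} (σ : FreeReversal N)

/-- The involution `(x, t) ↦ (σ x, 1 / t)` of `N × (0, ∞)`. -/
def neckFlip (z : neck N) : neck N :=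
  ⟨(σ.toFun z.1.1, halfInv z.1.2), by
    change 0 < halfCoord (halfInv z.1.2)
    rw [halfCoord_halfInv]
    exact inv_pos.2 z.2⟩

theorem neckFlip_involutive : Function.Involutive (neckFlip σ) := fun z =>
  Subtype.ext (Prod.ext (σ.involutive z.1.1) (halfInv_involutive z.1.2))

theorem neckFlip_ne (z : neck N) : neckFlip σ z ≠ z := fun h =>
  σ.ne_self z.1.1 (congrArg (fun w : neck N => w.1.1) h)

/- Both factors of the involution reverse orientations. -/
theorem neckFlip_oriented (z : neck N) :
    OrientedAt (halfModel p) (neckOrient N) (neckOrient N) (neckFlip σ) z := by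
  obtain ⟨a, ha, hinv⟩ := halfDiffeoAt_halfInv z.2
  have hmap : OrientedAt (halfModel p) (prodOrient N.or) (prodOrient N.or)
      (Prod.map σ.toFun halfInv) z.1 := (σ.oriented z.1.1).prodMap_neg hinv ha
  exact OrientedAt.of_subtypeVal_comp
    (OrientedAt.comp (φ := Subtype.val) hmap (orientedAt_subtypeVal _ _ z))

end Neck

section OfGlued

variable {p : ℕ} {V P : Type} [TopologicalSpace V] [ChartedSpace (HalfSpace p) V]
  [IsManifold (halfModel p) ∞ V] [T2Space V] [TopologicalSpace P] [ChartedSpace (HalfSpace p) P]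
  {o : V → Orientation ℝ (HalfSpaceVec p) (Fin (p + 1))}
  {oP : P → Orientation ℝ (HalfSpaceVec p) (Fin (p + 1))}

/-- The filling of `N` obtained by gluing an oriented manifold `V` with boundary `N` to itself away
from a collar of the boundary. -/
def Filling.ofGlued (N : ClosedManifold p) (G : SelfGluing (halfModel p) o oP)
    [CompactSpace G.Glued] (ho : ∀ x, ContOrientAt (halfModel p) o x)
    (c : N.carrier × EuclideanHalfSpace 1 → V) (hinj : Function.Injective (G.proj ∘ c))
    (hc : ∀ z, OrientedAt (halfModel p) (prodOrient N.or) o c z)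
    (hb : range (fun x : N.carrier => c (x, 0)) = (halfModel p).boundary V) : Filling N :=
  Filling.ofCollar N G.Glued G.orient (G.contOrientAt_orient finrank_halfSpaceVec ho) (G.proj ∘ c)
    hinj (fun z => (G.orientedAt_proj _).comp (hc z)) (by
      ext y
      obtain ⟨v, rfl⟩ := G.proj_surjective y
      refine ⟨?_, fun hv => ?_⟩
      · rintro ⟨x, hx⟩
        rw [← hx]
        exact G.proj_mem_boundary_iff.2 (hb ▸ mem_range_self x)
      · obtain ⟨x, rfl⟩ := hb ▸ G.proj_mem_boundary_iff.1 hv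
        exact ⟨x, rfl⟩)

end OfGlued

/-! ### The cylinder -/

section Cylinder

variable {p : ℕ} {N : ClosedManifold p} (σ : FreeReversal N)

/-- The gluing of `N × [0, ∞)` to itself along the involution `(x, t) ↦ (σ x, 1 / t)` of
`N × (0, ∞)`. -/
def cylinderGluing : SelfGluing (halfModel p) (prodOrient N.or) (neckOrient N) where
  emb := Subtype.val
  flip := neckFlip σ
  emb_injective := Subtype.val_injective
  flip_involutive := neckFlip_involutive σ
  flip_ne := neckFlip_ne σ
  emb_oriented := orientedAt_subtypeVal _ _
  flip_oriented := neckFlip_oriented σ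
  isClosed_graph := by
    have graph_eq : (range fun z : neck N => (z.1, (neckFlip σ z).1)) =
        {w | w.2.1 = σ.toFun w.1.1 ∧ halfCoord w.1.2 * halfCoord w.2.2 = 1} := by
      ext w
      constructor
      · rintro ⟨⟨⟨x, t⟩, ht⟩, rfl⟩
        refine ⟨rfl, ?_⟩
        change halfCoord t * halfCoord (halfInv t) = 1
        rw [halfCoord_halfInv]
        exact mul_inv_cancel₀ (ne_of_gt ht)
      · obtain ⟨⟨x, t⟩, y, u⟩ := w
        rintro ⟨hy : y = σ.toFun x, htu : halfCoord t * halfCoord u = 1⟩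
        subst hy
        have ht : 0 < halfCoord t :=
          (halfCoord_nonneg t).lt_of_ne' (left_ne_zero_of_mul_eq_one htu)
        have hu : halfInv t = u := halfCoord_injective
          ((halfCoord_halfInv t).trans (inv_eq_of_mul_eq_one_right htu))
        exact ⟨⟨(x, t), ht⟩, Prod.ext rfl (Prod.ext rfl hu)⟩
    rw [graph_eq]
    have := σ.continuous
    have := continuous_halfCoord
    exact (isClosed_eq (by fun_prop) (by fun_prop)).inter (isClosed_eq (by fun_prop) (by fun_prop))

instance : CompactSpace (cylinderGluing σ).Glued := by
  refine (cylinderGluing σ).compactSpace_glued (isCompact_univ.prod (isCompact_halfCoord_le 1))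
    fun z hz => ?_
  have hz' : 1 < halfCoord z.2 := not_le.1 fun h => hz ⟨trivial, h⟩
  refine ⟨⟨z, zero_lt_one.trans hz'⟩, rfl, trivial, ?_⟩
  change halfCoord (halfInv z.2) ≤ 1
  rw [halfCoord_halfInv]
  exact inv_le_one_of_one_le₀ hz'.le

theorem cylinderGluing_collar_injective :
    Function.Injective ((cylinderGluing σ).proj ∘ Prod.map id shrink) := by
  refine (cylinderGluing σ).proj_comp_injective (Function.injective_id.prodMap shrink_injective) ?_
  rintro ⟨⟨x, t⟩, ht⟩ ⟨⟨y, s⟩, hs⟩ ⟨⟨y', s'⟩, hs'⟩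
  have ht₁ : halfCoord t < 1 := (Prod.mk.inj hs).2 ▸ halfCoord_shrink_lt_one s
  have ht₂ : halfCoord (halfInv t) < 1 := (Prod.mk.inj hs').2 ▸ halfCoord_shrink_lt_one s'
  rw [halfCoord_halfInv] at ht₂
  exact absurd ht₂ (one_lt_inv₀ ht |>.2 ht₁).le.not_gt

/-- The cylinder with boundary `N`: the mapping cylinder of `N → N / σ`. -/
def cylinder : Filling N :=
  Filling.ofGlued N (cylinderGluing σ) (fun z => (N.contOrientAt z.1).prodOrient)
    (Prod.map id shrink) (cylinderGluing_collar_injective σ)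
    (fun z => by
      obtain ⟨a, ha, hshrink⟩ := halfDiffeoAt_shrink z.2
      exact (orientedAt_id N.or z.1).prodMap_pos hshrink ha)
    (by
      ext z
      refine Iff.trans ?_ isBoundaryPoint_prod_half.symm
      constructor
      · rintro ⟨x, rfl⟩
        exact shrink_zero
      · exact fun hz => ⟨z.1, Prod.ext rfl (shrink_zero.trans hz.symm)⟩)

theorem bounds_of_freeReversal {T : Type*} [TopologicalSpace T] {s : SingularMfd p T}
    (σ : FreeReversal s.dom) (hσ : ∀ x, s.map (σ.toFun x) = s.map x) : Bounds s :=
  ⟨cylinder σ,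
    (cylinderGluing σ).lift (s.map.comp ⟨Prod.fst, continuous_fst⟩) fun z => hσ z.1.1, fun _ => rfl⟩

theorem bounds_sum_neg {T : Type*} [TopologicalSpace T] (s : SingularMfd p T) :
    Bounds (s.sum s.neg) :=
  bounds_of_freeReversal s.dom.swap (ClosedManifold.sum_cases (fun _ => rfl) fun _ => rfl)

end Cylinder

/-! ### Gluing a filling to itself along part of its boundary -/

namespace Filling

variable {p : ℕ} {M N : ClosedManifold p} (W : Filling (M.sum N))

/-- The collar of the part `M` of the boundary `M ⊔ N`. -/
def collarLeft (z : M.carrier × EuclideanHalfSpace 1) : W.carrier := W.collar (M.inl N z.1, z.2)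

/-- The collar of the part `N` of the boundary `M ⊔ N`. -/
def collarRight (z : N.carrier × EuclideanHalfSpace 1) : W.carrier := W.collar (M.inr N z.1, z.2)

theorem collarLeft_oriented (z : M.carrier × EuclideanHalfSpace 1) :
    OrientedAt (halfModel p) (prodOrient M.or) W.or W.collarLeft z :=
  (W.collar_oriented _).comp ((M.inl_oriented N z.1).prodMap_pos (halfDiffeoAt_id z.2) one_pos)

theorem collarRight_oriented (z : N.carrier × EuclideanHalfSpace 1) :
    OrientedAt (halfModel p) (prodOrient N.or) W.or W.collarRight z :=
  (W.collar_oriented _).comp ((M.inr_oriented N z.1).prodMap_pos (halfDiffeoAt_id z.2) one_pos)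

theorem collarLeft_injective : Function.Injective W.collarLeft :=
  W.collar_injective.comp (ClosedManifold.inl_injective.prodMap Function.injective_id)

theorem collarRight_injective : Function.Injective W.collarRight :=
  W.collar_injective.comp (ClosedManifold.inr_injective.prodMap Function.injective_id)

theorem collarLeft_ne_collarRight (z : M.carrier × EuclideanHalfSpace 1)
    (w : N.carrier × EuclideanHalfSpace 1) : W.collarLeft z ≠ W.collarRight w := fun h =>
  ClosedManifold.inl_ne_inr _ _ (Prod.mk.inj (W.collar_injective h)).1

theorem isOpenEmbedding_collarRight : Topology.IsOpenEmbedding W.collarRight := by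
  have isLocalDiffeomorph : IsLocalDiffeomorph (halfModel p) (halfModel p) ∞ W.collarRight :=
    fun z => (W.collarRight_oriented z).diffeo
  exact .of_continuous_injective_isOpenMap isLocalDiffeomorph.contMDiff.continuous
    W.collarRight_injective isLocalDiffeomorph.isOpenMap

/-- The open manifold obtained by removing the part `N` of the boundary `M ⊔ N`. -/
def cut : TopologicalSpace.Opens W.carrier :=
  ⟨(range fun x => W.collarRight (x, 0))ᶜ, (isCompact_range
    (W.isOpenEmbedding_collarRight.continuous.comp (by fun_prop))).isClosed.isOpen_compl⟩

theorem collarLeft_mem_cut (z : M.carrier × EuclideanHalfSpace 1) : W.collarLeft z ∈ W.cut :=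
  fun ⟨_, hx⟩ => W.collarLeft_ne_collarRight _ _ hx.symm

theorem collarRight_mem_cut_iff {x : N.carrier} {t : EuclideanHalfSpace 1} :
    W.collarRight (x, t) ∈ W.cut ↔ 0 < halfCoord t := by
  refine ⟨fun h => (halfCoord_nonneg t).lt_of_ne' fun ht => h ⟨x, ?_⟩, ?_⟩
  · rw [halfCoord_injective (ht.trans halfCoord_zero.symm)]
  · rintro ht ⟨y, hy⟩
    rw [← (Prod.mk.inj (W.collarRight_injective hy)).2, halfCoord_zero] at ht
    exact ht.false

/-- The collar of the part `M` of the boundary, as a map to the complement of `N`. -/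
def cutCollar (z : M.carrier × EuclideanHalfSpace 1) : W.cut :=
  ⟨W.collarLeft z, W.collarLeft_mem_cut z⟩

theorem range_cutCollar_zero :
    range (fun x => W.cutCollar (x, 0)) = (halfModel p).boundary W.cut := by
  ext v
  have mem_boundary : v ∈ (halfModel p).boundary W.cut ↔
      v.1 ∈ (halfModel p).boundary W.carrier :=
    (isLocalDiffeomorphAt_subtypeVal W.cut v).isBoundaryPoint_iff (by simp)
  rw [mem_boundary, ← W.collar_boundary]
  constructor
  · rintro ⟨x, rfl⟩
    exact ⟨M.inl N x, rfl⟩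
  · rintro ⟨x, hx⟩
    induction x using ClosedManifold.sum_cases with
    | inl x => exact ⟨x, Subtype.ext hx⟩
    | inr x => exact absurd ⟨x, hx⟩ v.2

variable (σ : FreeReversal N)

/-- The embedding of `N × (0, ∞)` in the complement of `N`, with image the collar of length `1`. -/
def cutEmb (z : neck N) : W.cut :=
  ⟨W.collarRight (z.1.1, shrink z.1.2), W.collarRight_mem_cut_iff.2 (halfCoord_shrink_pos z.2)⟩

/- In the coordinate of the collar the involution is `(x, t) ↦ (σ x, 1 - t)` on `N × (0, 1)`, so the
closure of its graph in `W × W` adds only points with a coordinate in `N`. -/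
theorem isClosed_range_cutEmb_neckFlip :
    IsClosed (range fun z => (W.cutEmb z, W.cutEmb (neckFlip σ z))) := by
  let graph : N.carrier × EuclideanHalfSpace 1 → W.carrier × W.carrier := fun z =>
    (W.collarRight z, W.collarRight (σ.toFun z.1, mkHalf (1 - halfCoord z.2)))
  have continuous_graph : Continuous graph := by
    have := σ.continuous
    have := continuous_halfCoord
    have := continuous_mkHalf
    have := W.isOpenEmbedding_collarRight.continuous
    fun_prop
  have isClosed_image : IsClosed (graph '' (univ ×ˢ {t | halfCoord t ≤ 1})) :=
    ((isCompact_univ.prod (isCompact_halfCoord_le 1)).image continuous_graph).isClosed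
  have mkHalf_one_sub {t} (ht : 0 < halfCoord t) :
      mkHalf (1 - halfCoord (shrink t)) = shrink (halfInv t) := by
    rw [← halfCoord_shrink_halfInv ht, mkHalf_halfCoord]
  convert isClosed_image.preimage
    (continuous_subtype_val.prodMap continuous_subtype_val : Continuous
      (Prod.map (Subtype.val : W.cut → W.carrier) (Subtype.val : W.cut → W.carrier))) using 1
  ext ⟨v, w⟩
  constructor
  · rintro ⟨z, hz⟩
    obtain ⟨rfl, rfl⟩ := Prod.mk.inj hz
    refine ⟨(z.1.1, shrink z.1.2), ⟨trivial, (halfCoord_shrink_lt_one _).le⟩, ?_⟩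
    exact Prod.ext rfl (congrArg (fun u => W.collarRight (_, u)) (mkHalf_one_sub z.2))
  · rintro ⟨⟨x, t⟩, ⟨-, ht⟩, hvw⟩
    obtain ⟨hv : W.collarRight (x, t) = v, hw : W.collarRight (_, mkHalf _) = w⟩ :=
      Prod.mk.inj hvw
    have ht₀ : 0 < halfCoord t := W.collarRight_mem_cut_iff.1 (hv ▸ v.2)
    have ht₁ : halfCoord t < 1 := by
      have hpos : 0 < halfCoord (mkHalf (1 - halfCoord t)) :=
        W.collarRight_mem_cut_iff.1 (hw ▸ w.2)
      rw [halfCoord_mkHalf, lt_max_iff] at hpos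
      exact sub_pos.1 (hpos.resolve_right (lt_irrefl 0))
    obtain ⟨s, hs, rfl⟩ := exists_shrink_eq ht₀ ht₁
    refine ⟨⟨(x, s), hs⟩, Prod.ext (Subtype.ext hv) (Subtype.ext ?_)⟩
    exact (congrArg (fun u => W.collarRight (_, u)) (mkHalf_one_sub hs)).symm.trans hw

/-- The gluing of the complement of `N` to itself by an involution of the collar of `N`. -/
def gluing : SelfGluing (halfModel p) (restrictOrient (halfModel p) W.cut W.or) (neckOrient N) where
  emb := W.cutEmb
  flip := neckFlip σ
  emb_injective z w h := Subtype.ext <|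
    Function.injective_id.prodMap shrink_injective
      (W.collarRight_injective (congrArg Subtype.val h))
  flip_involutive := neckFlip_involutive σ
  flip_ne := neckFlip_ne σ
  emb_oriented z := by
    obtain ⟨a, ha, hshrink⟩ := halfDiffeoAt_shrink z.1.2
    have hmap : OrientedAt (halfModel p) (prodOrient N.or) (prodOrient N.or)
        (Prod.map id shrink) z.1 := (orientedAt_id N.or z.1.1).prodMap_pos hshrink ha
    exact OrientedAt.of_subtypeVal_comp (OrientedAt.comp (φ := Subtype.val)
      (OrientedAt.comp (W.collarRight_oriented _) hmap) (orientedAt_subtypeVal _ _ z))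
  flip_oriented := neckFlip_oriented σ
  isClosed_graph := W.isClosed_range_cutEmb_neckFlip σ

/- The half `N × [0, 1/2)` of the collar is redundant in the quotient. -/
instance : CompactSpace (W.gluing σ).Glued := by
  let C : Set W.carrier := (W.collarRight '' (univ ×ˢ {t | halfCoord t < 1 / 2}))ᶜ
  have isCompact_C : IsCompact C :=
    (W.isOpenEmbedding_collarRight.isOpenMap _ (isOpen_univ.prod
      (isOpen_lt continuous_halfCoord continuous_const))).isClosed_compl.isCompact
  have C_subset_cut : C ⊆ W.cut := by
    rintro w hw ⟨x, rfl⟩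
    refine hw ⟨(x, 0), ⟨trivial, ?_⟩, rfl⟩
    rw [mem_ofPred_eq, halfCoord_zero]
    exact one_half_pos
  refine (W.gluing σ).compactSpace_glued (C := Subtype.val ⁻¹' C) ?_ fun v hv => ?_
  · rw [Subtype.isCompact_iff]
    exact ((Subtype.image_preimage_coe _ _).trans (inter_eq_right.2 C_subset_cut)).symm ▸
      isCompact_C
  · obtain ⟨⟨x, t⟩, ⟨-, ht : halfCoord t < 1 / 2⟩, hxt⟩ := not_not.1 hv
    have ht₀ : 0 < halfCoord t := W.collarRight_mem_cut_iff.1 (hxt ▸ v.2)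
    obtain ⟨s, hs, rfl⟩ := exists_shrink_eq ht₀ (by linarith)
    refine ⟨⟨(x, s), hs⟩, Subtype.ext hxt, ?_⟩
    rintro ⟨⟨y, u⟩, ⟨-, hu : halfCoord u < 1 / 2⟩, hyu⟩
    rw [(Prod.mk.inj (W.collarRight_injective hyu)).2] at hu
    have := halfCoord_shrink_halfInv hs
    change halfCoord (shrink (halfInv s)) < 1 / 2 at hu
    linarith

/-- The filling of `M` obtained from a filling of `M ⊔ N` by gluing `N` to itself along an
orientation-reversing involution. -/
def glue : Filling M :=
  Filling.ofGlued M (W.gluing σ)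
    (fun _ => (W.contOrientAt _).comap finrank_halfSpaceVec
      (Eventually.of_forall (orientedAt_subtypeVal W.cut W.or)))
    W.cutCollar
    ((W.gluing σ).proj_comp_injective
      (fun _ _ h => W.collarLeft_injective (congrArg Subtype.val h))
      fun _ ⟨_, hw⟩ => absurd (congrArg Subtype.val hw) (W.collarLeft_ne_collarRight _ _))
    (fun z => OrientedAt.of_subtypeVal_comp (W.collarLeft_oriented z))
    W.range_cutCollar_zero

end Filling

theorem continuous_extend_of_isOpenEmbedding {A W T : Type*} [TopologicalSpace A]
    [TopologicalSpace W] [T2Space W] [TopologicalSpace T] {c : A → W}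
    (hc : Topology.IsOpenEmbedding c) {g : A → T} (hg : Continuous g) {f : W → T}
    (hf : Continuous f) {C : Set A} (hC : IsCompact C) (h : ∀ a ∉ C, g a = f (c a)) :
    Continuous (Function.extend c g f) := by
  have extend_apply (a : A) : Function.extend c g f (c a) = g a := hc.injective.extend_apply _ _ _
  refine continuous_iff_continuousAt.2 fun w => ?_
  by_cases hw : w ∈ range c
  · obtain ⟨a, rfl⟩ := hw
    rw [← hc.continuousAt_iff]
    exact hg.continuousAt.congr (Eventually.of_forall fun a => (extend_apply a).symm)
  · have compl_mem : (c '' C)ᶜ ∈ 𝓝 w :=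
      (hC.image hc.continuous).isClosed.isOpen_compl.mem_nhds fun ⟨a, _, ha⟩ => hw ⟨a, ha⟩
    refine hf.continuousAt.congr ?_
    filter_upwards [compl_mem] with y hy
    by_cases hy' : y ∈ range c
    · obtain ⟨a, rfl⟩ := hy'
      exact ((extend_apply a).trans (h a fun ha => hy ⟨a, ha, rfl⟩)).symm
    · exact (Function.extend_apply' _ _ _ hy').symm

theorem exists_collapse_collar {B W : Type*} [TopologicalSpace B] [CompactSpace B]
    [TopologicalSpace W] [T2Space W] {c : B × EuclideanHalfSpace 1 → W}
    (hc : Topology.IsOpenEmbedding c) :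
    ∃ r : C(W, W), (∀ b t, halfCoord t ≤ 1 → r (c (b, t)) = c (b, 0)) ∧
      ∀ w ∉ range c, r w = w := by
  -- a continuous self-map of `[0, ∞)` that vanishes on `[0, 1]` and is the identity on `[2, ∞)`
  let ρ (t : ℝ) : ℝ := max 0 (min t (2 * t - 2))
  let g (z : B × EuclideanHalfSpace 1) : W := c (z.1, mkHalf (ρ (halfCoord z.2)))
  have continuous_g : Continuous g := by
    have := continuous_halfCoord
    have := continuous_mkHalf
    have := hc.continuous
    fun_prop
  have g_eq : ∀ z ∉ univ ×ˢ {t | halfCoord t ≤ 2}, g z = c z := by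
    rintro ⟨b, t⟩ ht
    have ht : 2 < halfCoord t := not_le.1 fun h => ht ⟨trivial, h⟩
    have hρ : ρ (halfCoord t) = halfCoord t := by
      simp only [ρ]
      rw [min_eq_left (by linarith), max_eq_right (by linarith)]
    simp only [g, hρ, mkHalf_halfCoord]
  refine ⟨⟨Function.extend c g id, continuous_extend_of_isOpenEmbedding hc continuous_g
    continuous_id (isCompact_univ.prod (isCompact_halfCoord_le 2)) g_eq⟩, fun b t ht => ?_,
    fun w hw => Function.extend_apply' g id w hw⟩
  have hρ : ρ (halfCoord t) = 0 := max_eq_left (min_le_of_right_le (by linarith))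
  refine (hc.injective.extend_apply g id (b, t)).trans ?_
  simp only [g, hρ, mkHalf_zero]

section GluingBounds

variable {p : ℕ} {T : Type*} [TopologicalSpace T] {s t : SingularMfd p T}

theorem Bounds.of_sum_of_freeReversal (h : Bounds (s.sum t)) (σ : FreeReversal t.dom)
    (hσ : ∀ x, t.map (σ.toFun x) = t.map x) : Bounds s := by
  obtain ⟨W, K, hK⟩ := h
  have map_collarRight (x) : K (W.collarRight (x, 0)) = t.map x := hK (s.dom.inr t.dom x)
  obtain ⟨r, hr, hr'⟩ := exists_collapse_collar W.isOpenEmbedding_collarRight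
  let Kr : C(W.cut, T) := (K.comp r).comp ⟨Subtype.val, continuous_subtype_val⟩
  have Kr_cutEmb (z) : Kr (W.cutEmb z) = t.map z.1.1 :=
    (congrArg K (hr _ _ (halfCoord_shrink_lt_one _).le)).trans (map_collarRight _)
  refine ⟨W.glue σ, (W.gluing σ).lift Kr fun z => ?_, fun x => ?_⟩
  · exact (Kr_cutEmb _).trans ((hσ _).trans (Kr_cutEmb z).symm)
  · refine (congrArg K (hr' _ ?_)).trans (hK (s.dom.inl t.dom x))
    exact fun ⟨_, hz⟩ => W.collarLeft_ne_collarRight _ _ hz.symm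

theorem Bounds.of_sum_sum_neg (h : Bounds (s.sum (t.sum t.neg))) : Bounds s :=
  h.of_sum_of_freeReversal t.dom.swap
    (ClosedManifold.sum_cases (fun _ => rfl) fun _ => rfl)

end GluingBounds

/-! ### Oriented bordism of singular manifolds -/

section Bordism

variable {p : ℕ} {T : Type*} [TopologicalSpace T]

/-- The singular manifolds `s` and `t` differ by an oriented diffeomorphism of their domains. -/
def Iso (s t : SingularMfd p T) : Prop :=
  ∃ e : s.dom.carrier → t.dom.carrier, Function.Bijective e ∧
    (∀ x, OrientedAt (𝓡 p) s.dom.or t.dom.or e x) ∧ ∀ x, t.map (e x) = s.map x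

namespace Iso

open ClosedManifold

variable {s t u s' t' : SingularMfd p T}

protected theorem refl (s : SingularMfd p T) : Iso s s :=
  ⟨id, Function.bijective_id, orientedAt_id _, fun _ => rfl⟩

protected theorem symm (h : Iso s t) : Iso t s := by
  obtain ⟨e, he, e_oriented, map_e⟩ := h
  let g := (Equiv.ofBijective e he).symm
  have g_e (x) : g (e x) = x := (Equiv.ofBijective e he).symm_apply_apply x
  refine ⟨g, g.bijective, fun y => ?_, fun y => ?_⟩ <;> obtain ⟨x, rfl⟩ := he.2 y
  · have g_comp_e : g ∘ e = id := funext g_e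
    exact (e_oriented x).of_comp_right (g_comp_e ▸ orientedAt_id _ x)
  · rw [g_e, map_e]

protected theorem trans (h : Iso s t) (h' : Iso t u) : Iso s u := by
  obtain ⟨e, he, e_oriented, map_e⟩ := h
  obtain ⟨e', he', e'_oriented, map_e'⟩ := h'
  exact ⟨e' ∘ e, he'.comp he, fun x => (e'_oriented _).comp (e_oriented x),
    fun x => (map_e' _).trans (map_e x)⟩

theorem neg (h : Iso s t) : Iso s.neg t.neg := by
  obtain ⟨e, he, e_oriented, map_e⟩ := h
  exact ⟨e, he, fun x => (e_oriented x).neg, map_e⟩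

theorem push {A : Type*} [TopologicalSpace A] (k : C(T, A)) (h : Iso s t) :
    Iso (s.push k) (t.push k) := by
  obtain ⟨e, he, e_oriented, map_e⟩ := h
  exact ⟨e, he, e_oriented, fun x => congrArg k (map_e x)⟩

theorem sum (h : Iso s s') (h' : Iso t t') : Iso (s.sum t) (s'.sum t') := by
  obtain ⟨e, he, e_oriented, map_e⟩ := h
  obtain ⟨e', he', e'_oriented, map_e'⟩ := h'
  exact ⟨elim (fun x => s'.dom.inl t'.dom (e x)) (fun x => s'.dom.inr t'.dom (e' x)),
    he.sumMap he', elim_oriented (fun x => (inl_oriented _ _ _).comp (e_oriented x))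
      (fun x => (inr_oriented _ _ _).comp (e'_oriented x)), sum_cases map_e map_e'⟩

theorem sum_comm (s t : SingularMfd p T) : Iso (s.sum t) (t.sum s) :=
  ⟨elim (t.dom.inr s.dom) (t.dom.inl s.dom), (Equiv.sumComm _ _).bijective,
    elim_oriented (inr_oriented _ _) (inl_oriented _ _),
    sum_cases (fun _ => rfl) fun _ => rfl⟩

theorem sum_assoc (s t u : SingularMfd p T) : Iso ((s.sum t).sum u) (s.sum (t.sum u)) := by
  have inr_oriented' (x) := s.dom.inr_oriented (t.dom.sum u.dom) x
  exact ⟨elim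
      (elim (s.dom.inl (t.dom.sum u.dom)) (s.dom.inr (t.dom.sum u.dom) ∘ t.dom.inl u.dom))
      (s.dom.inr (t.dom.sum u.dom) ∘ t.dom.inr u.dom),
    (Equiv.sumAssoc _ _ _).bijective,
    elim_oriented
      (elim_oriented (inl_oriented _ _) fun x => (inr_oriented' _).comp (t.dom.inl_oriented _ x))
      (fun x => (inr_oriented' _).comp (t.dom.inr_oriented _ x)),
    sum_cases (sum_cases (fun _ => rfl) fun _ => rfl) fun _ => rfl⟩

theorem sum_sum_sum_comm (s t u v : SingularMfd p T) :
    Iso ((s.sum t).sum (u.sum v)) ((s.sum u).sum (t.sum v)) := by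
  have middle : Iso (t.sum (u.sum v)) (u.sum (t.sum v)) :=
    (sum_assoc t u v).symm.trans (((sum_comm t u).sum (Iso.refl v)).trans (sum_assoc u t v))
  exact (sum_assoc s t _).trans (((Iso.refl s).sum middle).trans (sum_assoc s u _).symm)

theorem neg_neg (s : SingularMfd p T) : Iso s.neg.neg s := by
  have or_eq : s.dom.or = s.dom.neg.neg.or := funext fun x => (_root_.neg_neg (s.dom.or x)).symm
  exact ⟨id, Function.bijective_id, fun x => or_eq ▸ orientedAt_id s.dom.or x, fun _ => rfl⟩

theorem neg_sum (s t : SingularMfd p T) : Iso (s.sum t).neg (s.neg.sum t.neg) := by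
  have or_eq : (s.dom.sum t.dom).neg.or = (s.dom.neg.sum t.dom.neg).or :=
    funext (sum_cases (fun _ => rfl) fun _ => rfl)
  exact ⟨id, Function.bijective_id,
    fun x => or_eq ▸ orientedAt_id (s.dom.sum t.dom).neg.or x, fun _ => rfl⟩

theorem sum_of_isEmpty (hs : IsEmpty s.dom.carrier) (t : SingularMfd p T) : Iso (s.sum t) t :=
  Iso.symm ⟨s.dom.inr t.dom, ⟨inr_injective, sum_cases (fun x => hs.elim x) fun x => ⟨x, rfl⟩⟩,
    inr_oriented _ _, fun _ => rfl⟩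

end Iso

theorem Bounds.of_iso {s t : SingularMfd p T} (ht : Bounds t) (h : Iso s t) : Bounds s := by
  obtain ⟨e, he, e_oriented, map_e⟩ := h
  exact ht.congr e he e_oriented map_e

/-- The singular manifolds `s` and `t` are bordant: `s ⊔ -t` bounds. -/
def Bordant (s t : SingularMfd p T) : Prop := Bounds (s.sum t.neg)

theorem Iso.bordant {s t : SingularMfd p T} (h : Iso s t) : Bordant s t :=
  (bounds_sum_neg s).of_iso ((Iso.refl s).sum h.neg.symm)

namespace Bordant

variable {s t u s' t' : SingularMfd p T}

protected theorem refl (s : SingularMfd p T) : Bordant s s := bounds_sum_neg s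

theorem neg (h : Bordant s t) : Bordant s.neg t.neg :=
  Bounds.of_iso (Bounds.neg h) (Iso.neg_sum s t.neg).symm

protected theorem symm (h : Bordant s t) : Bordant t s :=
  Bounds.of_iso h.neg ((Iso.sum_comm _ _).trans ((Iso.refl _).sum (Iso.neg_neg t).symm))

protected theorem trans (h : Bordant s t) (h' : Bordant t u) : Bordant s u := by
  have rearrange : Iso ((s.sum u.neg).sum (t.sum t.neg)) ((s.sum t.neg).sum (t.sum u.neg)) :=
    ((Iso.refl _).sum (Iso.sum_comm _ _)).trans
      ((Iso.sum_sum_sum_comm _ _ _ _).trans ((Iso.refl _).sum (Iso.sum_comm _ _)))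
  exact Bounds.of_sum_sum_neg ((Bounds.sum h h').of_iso rearrange)

theorem sum (h : Bordant s s') (h' : Bordant t t') : Bordant (s.sum t) (s'.sum t') :=
  (Bounds.sum h h').of_iso
    (((Iso.refl _).sum (Iso.neg_sum _ _)).trans (Iso.sum_sum_sum_comm _ _ _ _))

theorem neg_sum_self (s : SingularMfd p T) (ht : IsEmpty t.dom.carrier) :
    Bordant (s.neg.sum s) t :=
  (bounds_sum_neg s).of_iso ((Iso.sum_comm _ _).trans
    ((Iso.sum_of_isEmpty (s := t.neg) ht _).trans (Iso.sum_comm _ _)))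

end Bordant

/-- The empty closed manifold. -/
def ClosedManifold.empty (p : ℕ) : ClosedManifold p where
  carrier := Empty
  charted := ChartedSpace.empty _ _
  smooth :=
    let _ : ChartedSpace (EuclideanSpace ℝ (Fin p)) Empty := ChartedSpace.empty _ _
    IsManifold.empty _
  orient x := x.elim
  orient_continuous x := x.elim

instance : IsEmpty (ClosedManifold.empty p).carrier := inferInstanceAs (IsEmpty Empty)

/-- The empty singular manifold. -/
def SingularMfd.empty (p : ℕ) (T : Type*) [TopologicalSpace T] : SingularMfd p T where
  dom := ClosedManifold.empty p
  map := ⟨isEmptyElim, continuous_iff_continuousAt.2 fun x => isEmptyElim x⟩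

instance : IsEmpty (SingularMfd.empty p T).dom.carrier :=
  inferInstanceAs (IsEmpty (ClosedManifold.empty p).carrier)

theorem SingularMfd.push_sum {A : Type*} [TopologicalSpace A] (k : C(T, A))
    (s t : SingularMfd p T) : (s.sum t).push k = (s.push k).sum (t.push k) :=
  congrArg (SingularMfd.mk (s.dom.sum t.dom))
    (ContinuousMap.ext (ClosedManifold.sum_cases (fun _ => rfl) fun _ => rfl))

end Bordism

/-! ### Nielsen equivalence as bordism in the homotopy preimage -/

section HomotopyPreimage

variable {p : ℕ} {X Z : Type*} [TopologicalSpace X] [TopologicalSpace Z]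

/-- The homotopy preimage of `Y` under `f`: points `x` of `X` and `y` of `Y` with a path from `f x`
to `y`. -/
def HomotopyPreimage (f : C(X, Z)) (Y : Set Z) : Type _ :=
  {e : X × Y × C(unitInterval, Z) // e.2.2 0 = f e.1 ∧ e.2.2 1 = e.2.1}

instance (f : C(X, Z)) (Y : Set Z) : TopologicalSpace (HomotopyPreimage f Y) :=
  instTopologicalSpaceSubtype

/-- The inclusion of the preimage into the homotopy preimage by constant paths. -/
def constPath (f : C(X, Z)) (Y : Set Z) : C(f ⁻¹' Y, HomotopyPreimage f Y) where
  toFun x := ⟨(x, ⟨f x, x.2⟩, ContinuousMap.const _ (f x)), rfl, rfl⟩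
  continuous_toFun := by
    refine Continuous.subtype_mk (continuous_subtype_val.prodMk (Continuous.prodMk ?_ ?_)) _
    · fun_prop
    · exact ContinuousMap.continuous_const'.comp (f.continuous.comp continuous_subtype_val)

variable {f : C(X, Z)} {Y : Set Z}

theorem NielsenEquiv.bordant {s t : SingularMfd p (f ⁻¹' Y)} (h : NielsenEquiv f Y s t) :
    Bordant (s.push (constPath f Y)) (t.push (constPath f Y)) := by
  obtain ⟨W, H, G, H_left, H_right, G_left, G_right, ⟨Φ⟩⟩ := h
  let γ : C(W.carrier, C(unitInterval, Z)) :=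
    ContinuousMap.curry ⟨fun z => Φ (z.2, z.1), by fun_prop⟩
  have γ_apply (w r) : γ w r = Φ (r, w) := rfl
  let K : C(W.carrier, HomotopyPreimage f Y) :=
    ⟨fun w => ⟨(H w, G w, γ w), by simp [γ_apply], by simp [γ_apply]⟩,
      Continuous.subtype_mk (by fun_prop) _⟩
  have K_eq {w : W.carrier} (hw : w ∈ range W.left ∪ range W.right) {x : f ⁻¹' Y}
      (hH : H w = x) (hG : (G w : Z) = f x) : K w = constPath f Y x := by
    refine Subtype.ext (Prod.ext hH (Prod.ext (Subtype.ext hG) (ContinuousMap.ext fun r => ?_)))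
    exact (Φ.eq_fst r hw).trans (congrArg f hH)
  exact ⟨W, K, ClosedManifold.sum_cases
    (fun x => K_eq (Or.inl ⟨x, rfl⟩) (H_left x) (G_left x))
    (fun x => K_eq (Or.inr ⟨x, rfl⟩) (H_right x) (G_right x))⟩

theorem NielsenEquiv.of_bordant {s t : SingularMfd p (f ⁻¹' Y)}
    (h : Bordant (s.push (constPath f Y)) (t.push (constPath f Y))) : NielsenEquiv f Y s t := by
  obtain ⟨W, K, hK⟩ := h
  have K_left (x) := hK (s.dom.inl t.dom.neg x)
  have K_right (x) := hK (s.dom.inr t.dom.neg x)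
  have : Continuous fun w => (K w).1 := continuous_subtype_val.comp K.continuous
  let H : C(W.carrier, X) := ⟨fun w => (K w).1.1, by fun_prop⟩
  let G : C(W.carrier, Y) := ⟨fun w => (K w).1.2.1, by fun_prop⟩
  have path_eq {w : W.carrier} {x : f ⁻¹' Y} (hw : K w = constPath f Y x) (r) :
      (K w).1.2.2 r = f (K w).1.1 := by
    rw [hw]
    rfl
  refine ⟨W, H, G, fun x => congrArg (fun e => e.1.1) (K_left x),
    fun x => congrArg (fun e => e.1.1) (K_right x),
    fun x => congrArg (fun e => (e.1.2.1 : Z)) (K_left x),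
    fun x => congrArg (fun e => (e.1.2.1 : Z)) (K_right x), ⟨?_⟩⟩
  refine ⟨⟨⟨fun z => (K z.2).1.2.2 z.1, by fun_prop⟩, fun w => (K w).2.1, fun w => (K w).2.2⟩, ?_⟩
  rintro r _ (⟨x, rfl⟩ | ⟨x, rfl⟩)
  exacts [path_eq (K_left x) r, path_eq (K_right x) r]

theorem nielsenEquiv_iff_bordant {s t : SingularMfd p (f ⁻¹' Y)} :
    NielsenEquiv f Y s t ↔ Bordant (s.push (constPath f Y)) (t.push (constPath f Y)) :=
  ⟨NielsenEquiv.bordant, NielsenEquiv.of_bordant⟩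

theorem nielsenEquiv_equivalence : Equivalence (NielsenEquiv f Y (p := p)) where
  refl _ := .of_bordant (.refl _)
  symm h := .of_bordant h.bordant.symm
  trans h h' := .of_bordant (h.bordant.trans h'.bordant)

theorem NielsenEquiv.of_iso {s t : SingularMfd p (f ⁻¹' Y)} (h : Iso s t) : NielsenEquiv f Y s t :=
  .of_bordant (h.push _).bordant

theorem NielsenEquiv.neg {s t : SingularMfd p (f ⁻¹' Y)} (h : NielsenEquiv f Y s t) :
    NielsenEquiv f Y s.neg t.neg :=
  .of_bordant h.bordant.neg

theorem NielsenEquiv.sum {s s' t t' : SingularMfd p (f ⁻¹' Y)} (h : NielsenEquiv f Y s s')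
    (h' : NielsenEquiv f Y t t') : NielsenEquiv f Y (s.sum t) (s'.sum t') := by
  rw [nielsenEquiv_iff_bordant, SingularMfd.push_sum, SingularMfd.push_sum]
  exact h.bordant.sum h'.bordant

theorem NielsenEquiv.neg_sum_self (s : SingularMfd p (f ⁻¹' Y)) :
    NielsenEquiv f Y (s.neg.sum s) (SingularMfd.empty p _) := by
  rw [nielsenEquiv_iff_bordant, SingularMfd.push_sum]
  have isEmpty_push : IsEmpty ((SingularMfd.empty p (f ⁻¹' Y)).push (constPath f Y)).dom.carrier :=
    inferInstanceAs (IsEmpty (ClosedManifold.empty p).carrier)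
  exact Bordant.neg_sum_self (s.push (constPath f Y)) isEmpty_push

theorem nielsenClass_eq_iff {s t : SingularMfd p (f ⁻¹' Y)} :
    nielsenClass f Y s = nielsenClass f Y t ↔ NielsenEquiv f Y s t :=
  ⟨fun h => nielsenEquiv_equivalence.eqvGen_iff.1 (Quot.eqvGen_exact h), Quot.sound⟩

end HomotopyPreimage

/-! ### The group of Nielsen classes -/

section NielsenGroup

variable {p : ℕ} {X Z : Type*} [TopologicalSpace X] [TopologicalSpace Z] {f : C(X, Z)} {Y : Set Z}

/-- Addition of Nielsen classes by disjoint union. Like the rest of the group structure it is not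
registered as a global instance: where a group structure on the Nielsen classes is quantified over,
`+` must refer to the quantified one. -/
abbrev NielsenClasses.instAdd : Add (NielsenClasses f Y p) where
  add := Quot.map₂ SingularMfd.sum
    (fun s _ _ h => (nielsenEquiv_equivalence.refl s).sum h)
    (fun _ _ t h => h.sum (nielsenEquiv_equivalence.refl t))

/-- The Nielsen class of the empty manifold. -/
abbrev NielsenClasses.instZero : Zero (NielsenClasses f Y p) where
  zero := nielsenClass f Y (SingularMfd.empty p _)

/-- Negation of Nielsen classes by reversal of the orientation. -/
abbrev NielsenClasses.instNeg : Neg (NielsenClasses f Y p) where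
  neg := Quot.map SingularMfd.neg fun _ _ h => h.neg

attribute [local instance] NielsenClasses.instAdd NielsenClasses.instZero NielsenClasses.instNeg

/-- The abelian group of Nielsen classes under disjoint union. -/
abbrev NielsenClasses.addCommGroup (f : C(X, Z)) (Y : Set Z) (p : ℕ) :
    AddCommGroup (NielsenClasses f Y p) where
  nsmul := nsmulRec
  zsmul := zsmulRec
  add_assoc := by
    rintro ⟨s⟩ ⟨t⟩ ⟨u⟩
    exact Quot.sound (.of_iso (Iso.sum_assoc s t u))
  zero_add := by
    rintro ⟨s⟩
    exact Quot.sound (.of_iso (Iso.sum_of_isEmpty inferInstance s))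
  add_zero := by
    rintro ⟨s⟩
    exact Quot.sound (.of_iso ((Iso.sum_comm _ _).trans (Iso.sum_of_isEmpty inferInstance s)))
  add_comm := by
    rintro ⟨s⟩ ⟨t⟩
    exact Quot.sound (.of_iso (Iso.sum_comm s t))
  neg_add_cancel := by
    rintro ⟨s⟩
    exact Quot.sound (.neg_sum_self s)

attribute [local instance] NielsenClasses.addCommGroup

theorem nielsenClass_add (s t : SingularMfd p (f ⁻¹' Y)) :
    nielsenClass f Y s + nielsenClass f Y t = nielsenClass f Y (s.sum t) := rfl

/-- The homomorphism of groups of Nielsen classes induced by a morphism of preimage problems. -/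
def inducedHom {X' Z' : Type*} [TopologicalSpace X'] [TopologicalSpace Z']
    {f' : C(X', Z')} {Y' : Set Z'} (k : C(X, X')) (h : C(Z, Z'))
    (comm : ∀ x, f' (k x) = h (f x)) (hY : MapsTo h Y Y') (p : ℕ) :
    NielsenClasses f Y p →+ NielsenClasses f' Y' p :=
  AddMonoidHom.mk' (inducedMap k h comm hY p) (by
    rintro ⟨s⟩ ⟨t⟩
    exact congrArg (nielsenClass f' Y') (SingularMfd.push_sum _ s t))

end NielsenGroup

/-! ### Nielsen classes of a homotopy -/

section Homotopy

variable {p : ℕ} {X Z : Type*} [TopologicalSpace X] [TopologicalSpace Z] {f : C(X, Z)} {Y : Set Z}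
  {F : C(unitInterval × X, Z)}

/- The deformation is `(r, w) ↦ F (r t, x)`, where `H w = (t, x)`. -/
theorem homotopicRel_comp_snd (hF : ∀ x, F (0, x) = f x) {W : Type*} [TopologicalSpace W]
    (H : C(W, unitInterval × X)) {S : Set W} (hS : ∀ w ∈ S, (H w).1 = 0) :
    ContinuousMap.HomotopicRel (f.comp (ContinuousMap.snd.comp H)) (F.comp H) S := by
  refine ⟨⟨⟨⟨fun z => F (z.1 * (H z.2).1, (H z.2).2), by fun_prop⟩, fun w => ?_, fun w => ?_⟩,
    fun r w hw => ?_⟩⟩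
  · change F (0 * (H w).1, (H w).2) = f (H w).2
    rw [zero_mul, hF]
  · change F (1 * (H w).1, (H w).2) = F (H w)
    rw [one_mul]
  · change F (r * (H w).1, (H w).2) = f (H w).2
    rw [hS w hw, mul_zero, hF]

theorem nielsenEquiv_of_push_inclZero (hF : ∀ x, F (0, x) = f x)
    {s t : SingularMfd p (f ⁻¹' Y)}
    (h : NielsenEquiv F Y
      (s.push (preimageMap (inclZero X) (ContinuousMap.id Z) hF (mapsTo_id Y)))
      (t.push (preimageMap (inclZero X) (ContinuousMap.id Z) hF (mapsTo_id Y)))) :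
    NielsenEquiv f Y s t := by
  obtain ⟨W, H, G, H_left, H_right, G_left, G_right, homotopic⟩ := h
  have time_zero : ∀ w ∈ range W.left ∪ range W.right, (H w).1 = 0 := by
    rintro _ (⟨x, rfl⟩ | ⟨x, rfl⟩)
    exacts [congrArg Prod.fst (H_left x), congrArg Prod.fst (H_right x)]
  exact ⟨W, ContinuousMap.snd.comp H, G, fun x => congrArg Prod.snd (H_left x),
    fun x => congrArg Prod.snd (H_right x), fun x => (G_left x).trans (hF _),
    fun x => (G_right x).trans (hF _), (homotopicRel_comp_snd hF H time_zero).trans homotopic⟩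

theorem inducedMap_inclZero_injective (hF : ∀ x, F (0, x) = f x) :
    Function.Injective (inducedMap (inclZero X) (ContinuousMap.id Z) hF (mapsTo_id Y) p) := by
  rintro ⟨s⟩ ⟨t⟩ h
  exact Quot.sound (nielsenEquiv_of_push_inclZero hF (nielsenClass_eq_iff.1 h))

end Homotopy

end

end NielsenBordism

theorem mainTheorem1 {X Z : Type*} [TopologicalSpace X] [TopologicalSpace Z] (Y : Set Z)
    (f : C(X, Z)) (F : C(unitInterval × X, Z)) (hF : ∀ x, F (0, x) = f x) (p : ℕ) :
    ∃ (_ : AddCommGroup (NielsenClasses f Y p)) (_ : AddCommGroup (NielsenClasses F Y p))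
      (φ : NielsenClasses f Y p →+ NielsenClasses F Y p),
      (∀ s t : SingularMfd p (f ⁻¹' Y),
        nielsenClass f Y s + nielsenClass f Y t = nielsenClass f Y (s.sum t)) ∧
      (∀ s t : SingularMfd p (F ⁻¹' Y),
        nielsenClass F Y s + nielsenClass F Y t = nielsenClass F Y (s.sum t)) ∧
      (∀ a, φ a = inducedMap (inclZero X) (ContinuousMap.id Z) hF (Set.mapsTo_id Y) p a) ∧
      Function.Injective φ := by
  exact ⟨NielsenClasses.addCommGroup f Y p, NielsenClasses.addCommGroup F Y p,
    inducedHom (inclZero X) (ContinuousMap.id Z) hF (Set.mapsTo_id Y) p,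
    nielsenClass_add, nielsenClass_add, fun _ => rfl, inducedMap_inclZero_injective hF⟩
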